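/- \textbf{Setting.} Let $(X_i,Y_i)$, $i=1,2,\dots$, be iid pairs of real random variables, let $F_{Y|X}(\cdot\mid x)$, $x\in\mathbb R$, be (a version of) the conditional distribution function of $Y$ given $X=x$ (from a regular conditional distribution), let $x_0\in\mathbb R$ be a cutoff, $q\ge 1$ an integer and $\alpha\in(0,1)$. \textbf{Two-sample Dirichlet procedure.} For $1\le k\le n$ let $B_{k,n}^{p}$ be the $p$-quantile of the $\mathrm{Beta}(k,n+1-k)$ distribution, equal to $0$ if $p\le 0$ and $1$ if $p\ge 1$; put $B_{0,n}^{p}=0$ and $B_{n+1,n}^{p}=1$. For samples $U=(U_1,\dots,U_m)$ and $V=(V_1,\dots,V_n)$ with empirical distribution functions $\hat F_U,\hat F_V$ and a pointwise level $a$, let $$\hat\ell_U(r)=B^{a}_{m\hat F_U(r),m},\quad \hat u_U(r)=B^{1-a}_{m\hat F_U(r)+1,m},$$ and similarly $\hat\ell_V,\hat u_V$ (with $n$). For the family $F_U(r)=F_V(r)$, $r\in\mathbb R$, reject at $r$ iff $\hat\ell_U(r)>\hat u_V(r)$ or $\hat\ell_V(r)>\hat u_U(r)$; for the family $F_U(r)\le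 F_V(r)$, reject at $r$ iff $\hat\ell_U(r)>\hat u_V(r)$; for the family $F_U(r)\ge F_V(r)$, reject at $r$ iff $\hat\ell_V(r)>\hat u_U(r)$. The procedure uses $a=a^*-0.0001$, where $a^*$ is the supremum of the $a\in(0,1)$ for which, when $U$ and $V$ are independent samples of iid $\mathrm{Unif}(0,1)$ variables, the (exact) probability of rejecting at some $r\in\mathbb R$ is at most $\alpha$ (calibrated separately for each of the three families). \textbf{Regression-discontinuity procedure.} From $(X_1,Y_1),\dots,(X_n,Y_n)$ let $Y^-_{[1]},\dots,Y^-_{[q]}$ be the outcomes of the $q$ observations with $X_i<x_0$ nearest to $x_0$, and $Y^+_{[1]},\dots,Y^+_{[q]}$ those of the $q$ observations with $X_i\ge x_0$ nearest to $x_0$ (ties in $X$ broken by the index). Apply the two-sample Dirichlet procedure to $U=(Y^-_{[1]},\dots,Y^-_{[q]})$ and $V=(Y^+_{[1]},\dots,Y^+_{[q]})$; nothing is rejected if one side has fewer than $q$ observations. Given distribution functions $F^-$, $F^+$ put $\Delta(r)=F^+(r)-F^-(r)$. The family tested is either $H_{0r}\colon\Delta(r)=0$, or $H_{0r}\colon\Delta(r)\ge0$,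 or $H_{0r}\colon\Delta(r)\le0$, $r\in\mathbb R$. A familywise error is the rejection of $H_{0r}$ for at least one $r$ at which $H_{0r}$ is true, and $\mathrm{FWER}_n$ is its probability. \textbf{Theorem.} Assume that $F^-$ and $F^+$ are distribution functions of probability measures on $\mathbb R$ which are continuous and strictly increasing on $\mathbb R$, and that $\Pr(X\in[x_0-\epsilon,x_0))>0$ and $\Pr(X\in[x_0,x_0+\epsilon])>0$ for every $\epsilon>0$. Then for each of the three families of hypotheses: (a) (Asymptotic strong control.) Suppose that $F^-(r)=\lim_{x\uparrow x_0}F_{Y|X}(r\mid x)$ for all $r$; that $F^+(r)=\lim_{x\downarrow x_0}F_{Y|X}(r\mid x)$ for all $r$ if $\Pr(X=x_0)=0$, whereas $F^+(r)=F_{Y|X}(r\mid x_0)$ for all $r$ if $\Pr(X=x_0)>0$; that for some $\epsilon>0$, for every $y\in\mathbb R$, $x\mapsto F_{Y|X}(y\mid x)$ is left-continuous at every point of $[x_0-\epsilon,x_0)$; and that either $\Pr(X=x_0)>0$ or $x\mapsto F_{Y|X}(y\mid x)$ is right-continuous at $x_0$ for every $y\in\mathbb R$. Then $\limsup_{n\to\infty}\mathrm{FWER}_n\le\alpha$.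 (b) (Finite-sample strong control.) Suppose instead that for some $\underline x<x_0\le\bar x$ one has $F_{Y|X}(\cdot\mid x)=F^-$ for all $x\in[\underline x,x_0)$ and $F_{Y|X}(\cdot\mid x)=F^+$ for all $x\in[x_0,\bar x]$. Then for every $n$, conditionally on the event that at least $q$ of $X_1,\dots,X_n$ lie in $[\underline x,x_0)$ and at least $q$ lie in $[x_0,\bar x]$ (if this event has positive probability), the probability of a familywise error is at most $\alpha$. -/

import Mathlib

open MeasureTheory ProbabilityTheory Set Filter
open scoped Topology ENNReal

noncomputable section

namespace DirichletRD

/-! ### The two-sample Dirichlet multiple testing procedure -/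

/-- The quantile `B_{k,n}^p` of order `p` of the `Beta(k, n+1-k)` distribution for `1 ≤ k ≤ n`,
with the conventions `B_{0,n}^p = 0` and `B_{n+1,n}^p = 1`.  The Beta distribution function is
continuous and strictly increasing on `[0,1]`, so for `0 ≤ p ≤ 1` the supremum below is the unique
`t ∈ [0,1]` at which it equals `p`; it is `0` for `p ≤ 0` and `1` for `p ≥ 1`. -/
def betaQuantile (k n : ℕ) (p : ℝ) : ℝ :=
  if k = 0 then 0
  else if n < k then 1
  else sSup {t : ℝ | t ∈ Icc (0 : ℝ) 1 ∧ cdf (betaMeasure (k : ℝ) ((n : ℝ) + 1 - (k : ℝ))) t ≤ p}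

/-- `n * F̂(r)`: the sample size times the empirical distribution function of the sample `v`,
that is, the number of observations `≤ r`. -/
def ecdfCount {n : ℕ} (v : Fin n → ℝ) (r : ℝ) : ℕ :=
  (Finset.univ.filter fun i => v i ≤ r).card

/-- Lower band `ℓ̂(r) = B_{nF̂(r), n}^a`. -/
def lowerBand {n : ℕ} (a : ℝ) (v : Fin n → ℝ) (r : ℝ) : ℝ :=
  betaQuantile (ecdfCount v r) n a

/-- Upper band `û(r) = B_{nF̂(r)+1, n}^{1-a}`. -/
def upperBand {n : ℕ} (a : ℝ) (v : Fin n → ℝ) (r : ℝ) : ℝ :=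
  betaQuantile (ecdfCount v r + 1) n (1 - a)

/-- The three families of null hypotheses on two distribution functions `F_U`, `F_V`. -/
inductive NullFamily where
  | eq
  | le
  | ge

/-- The null hypothesis at `r`: `F_U(r) = F_V(r)`, `F_U(r) ≤ F_V(r)` or `F_U(r) ≥ F_V(r)`. -/
def NullFamily.Holds (H : NullFamily) (FU FV : ℝ) : Prop :=
  match H with
  | .eq => FU = FV
  | .le => FU ≤ FV
  | .ge => FV ≤ FU

/-- Rejection of the null hypothesis at `r` from the samples `u`, `v` with pointwise level `a`. -/
def Rejects (H : NullFamily) {m n : ℕ} (a : ℝ) (u : Fin m → ℝ) (v : Fin n → ℝ) (r : ℝ) : Prop :=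
  match H with
  | .eq => upperBand a v r < lowerBand a u r ∨ upperBand a u r < lowerBand a v r
  | .le => upperBand a v r < lowerBand a u r
  | .ge => upperBand a u r < lowerBand a v r

/-- The law of `n` independent standard uniform random variables. -/
def unifSample (n : ℕ) : Measure (Fin n → ℝ) :=
  Measure.pi fun _ => (volume : Measure ℝ).restrict (Icc 0 1)

/-- The probability of rejecting at least one hypothesis with pointwise level `a` when the data are
two independent samples of independent standard uniform variables, of sizes `m` and `n`. -/
def unifFWER (H : NullFamily) (m n : ℕ) (a : ℝ) : ℝ≥0∞ :=
  ((unifSample m).prod (unifSample n)) {p | ∃ r : ℝ, Rejects H a p.1 p.2 r}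

/-- The calibrated pointwise level: the largest `a` for which the familywise error rate with
uniform data is at most `α`, minus `0.0001`. -/
def calibratedLevel (H : NullFamily) (m n : ℕ) (α : ℝ) : ℝ :=
  sSup {a : ℝ | a ∈ Ioo (0 : ℝ) 1 ∧ unifFWER H m n a ≤ ENNReal.ofReal α} - 1 / 10000

/-- The two-sample Dirichlet procedure with nominal familywise error rate `α`. -/
def DirichletRejects (H : NullFamily) (α : ℝ) {m n : ℕ} (u : Fin m → ℝ) (v : Fin n → ℝ)
    (r : ℝ) : Prop :=
  Rejects H (calibratedLevel H m n α) u v r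

/-! ### Observations nearest the cutoff

The sample of size `n` is `(x 0, y 0), …, (x (n-1), y (n-1))`. -/

/-- Indices of the observations with running variable in the set `S`. -/
def obsIn (n : ℕ) (x : ℕ → ℝ) (S : Set ℝ) : Finset ℕ :=
  open Classical in (Finset.range n).filter fun k => x k ∈ S

/-- The number of observations on the left of `x₀` that are strictly nearer to `x₀` than
observation `k`; equal values of the running variable are ordered by their index. -/
def leftRank (x₀ : ℝ) (n : ℕ) (x : ℕ → ℝ) (k : ℕ) : ℕ :=
  ((obsIn n x (Iio x₀)).filter fun i => x k < x i ∨ (x i = x k ∧ i < k)).card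

/-- The number of observations with running variable `≥ x₀` that are strictly nearer to `x₀` than
observation `k`; equal values of the running variable are ordered by their index. -/
def rightRank (x₀ : ℝ) (n : ℕ) (x : ℕ → ℝ) (k : ℕ) : ℕ :=
  ((obsIn n x (Ici x₀)).filter fun i => x i < x k ∨ (x i = x k ∧ i < k)).card

/-- The outcomes `(Y⁻_[1], …, Y⁻_[q])` of the `q` observations nearest to `x₀` on its left: entry
`j` is the outcome of the observation of left rank `j`.  If there are more than `j` observations
on the left, the sum has exactly one term; otherwise it is empty. -/
def leftSample (x₀ : ℝ) (q n : ℕ) (x y : ℕ → ℝ) : Fin q → ℝ := fun j =>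
  ∑ k ∈ (obsIn n x (Iio x₀)).filter (fun k => leftRank x₀ n x k = (j : ℕ)), y k

/-- The outcomes `(Y⁺_[1], …, Y⁺_[q])` of the `q` observations nearest to `x₀` with running
variable `≥ x₀`. -/
def rightSample (x₀ : ℝ) (q n : ℕ) (x y : ℕ → ℝ) : Fin q → ℝ := fun j =>
  ∑ k ∈ (obsIn n x (Ici x₀)).filter (fun k => rightRank x₀ n x k = (j : ℕ)), y k

/-- The regression-discontinuity procedure: the two-sample Dirichlet procedure is applied to the
`q` outcomes nearest the cutoff on each side.  Nothing is rejected if one side has fewer than `q`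
observations. -/
def RDRejects (H : NullFamily) (α x₀ : ℝ) (q n : ℕ) (x y : ℕ → ℝ) (r : ℝ) : Prop :=
  q ≤ (obsIn n x (Iio x₀)).card ∧ q ≤ (obsIn n x (Ici x₀)).card ∧
    DirichletRejects H α (leftSample x₀ q n x y) (rightSample x₀ q n x y) r

/-! ### The population -/

/-- The conditional distribution function `F_{Y|X}(y | x)`, for a regular conditional distribution
`κ` of `Y` given `X`. -/
def condF (κ : Kernel ℝ ℝ) (y x : ℝ) : ℝ := cdf (κ x) y

/-- The distribution function of `ν` is continuous and strictly increasing on `ℝ`. -/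
def RegularCDF (ν : Measure ℝ) : Prop :=
  Continuous (fun r => cdf ν r) ∧ StrictMono (fun r => cdf ν r)

/-- `ν` is the left boundary distribution: `F_ν(r) = lim_{x ↑ x₀} F_{Y|X}(r | x)` for all `r`. -/
def IsLeftBoundary (κ : Kernel ℝ ℝ) (x₀ : ℝ) (ν : Measure ℝ) : Prop :=
  ∀ r : ℝ, Tendsto (condF κ r) (𝓝[<] x₀) (𝓝 (cdf ν r))

/-- `ν` is the right boundary distribution: `F_ν(r) = lim_{x ↓ x₀} F_{Y|X}(r | x)` for all `r`,
except that `F_ν = F_{Y|X}(· | x₀)` if the law `PX` of the running variable has an atom at `x₀`. -/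
def IsRightBoundary (PX : Measure ℝ) (κ : Kernel ℝ ℝ) (x₀ : ℝ) (ν : Measure ℝ) : Prop :=
  (0 < PX {x₀} → ∀ r : ℝ, condF κ r x₀ = cdf ν r) ∧
  (PX {x₀} = 0 → ∀ r : ℝ, Tendsto (condF κ r) (𝓝[>] x₀) (𝓝 (cdf ν r)))

/-- The familywise error event of the procedure for the sample of size `n`: some true hypothesis
is rejected.  The hypothesis at `r` compares `F⁻(r)` with `F⁺(r)`, so that `eq`, `le`, `ge` stand
for `Δ(r) = 0`, `Δ(r) ≥ 0`, `Δ(r) ≤ 0` with `Δ = F⁺ - F⁻`. -/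
def familywiseError {Ω : Type*} (H : NullFamily) (α x₀ : ℝ) (q n : ℕ) (νm νp : Measure ℝ)
    (X Y : ℕ → Ω → ℝ) : Set Ω :=
  {ω | ∃ r : ℝ, H.Holds (cdf νm r) (cdf νp r) ∧
    RDRejects H α x₀ q n (fun i => X i ω) (fun i => Y i ω) r}

end DirichletRD

end

open DirichletRD

/-! The inverse transform writes each outcome as `condQuantile κ (X i) (U i)`, where the `U i` are
iid uniform and independent of all running variables (`map_sample_eq`). Which observations are
nearest the cutoff depends on the running variables alone. Hence, given these, the uniforms behind
the two nearest-neighbour samples are two independent uniform samples of size `q`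
(`measure_blurredReject_nearest`).

An outcome is at most `r` exactly when its uniform is at most `F(r | x)`. If `F(r | x)` is within
`δ` of the boundary value at all selected points, each count at `r` lies between the counts of
uniforms at the boundary value minus and plus `δ`. The bands are monotone in the count (the Beta
laws are stochastically ordered), so rejecting a true hypothesis forces a rejection between the
uniform samples with evaluation points displaced by `δ` (`blurredReject_of_rejects`). By Fubini, the
error probability on the event that both windows hold `q` observations is at most that event's
probability times the displaced rejection probability (`measure_error_inter_enoughObs_le`).

With `δ = 0` this bound and the calibration give the finite-sample claim. For the asymptotic one,
each `δ > 0` admits windows, because convergence to a continuous distribution function is uniform,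
and the windows fill up with probability tending to one. The limsup is thus at most the displaced
rejection probability for every `δ > 0`. As `δ` decreases to `0`, this tends to the undisplaced one,
since ties between the two uniform samples are null (`le_unifFWER_of_forall_le_blurred`). -/

/-! ### Stochastic ordering of Beta laws and monotonicity of their quantiles -/

/-- The likelihood ratio is a multiple of `x / (1 - x)`, which increases on `(0, 1)`, so the
densities cross once. -/
lemma betaPDF_le_betaPDF_shift {a b : ℝ} (ha : 0 < a) (hb : 1 < b) :
    ∃ c : ℝ, (∀ x ≤ c, betaPDF (a + 1) (b - 1) x ≤ betaPDF a b x) ∧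
      ∀ x, c ≤ x → betaPDF a b x ≤ betaPDF (a + 1) (b - 1) x := by
  have hC : 0 < 1 / beta a b := one_div_pos.2 (beta_pos ha (by linarith))
  have hC' : 0 < 1 / beta (a + 1) (b - 1) := one_div_pos.2 (beta_pos (by linarith) (by linarith))
  set C := 1 / beta a b
  set C' := 1 / beta (a + 1) (b - 1)
  have key : ∀ x : ℝ, 0 < x → x < 1 → ∃ g : ℝ, 0 ≤ g ∧
      C * x ^ (a - 1) * (1 - x) ^ (b - 1) = g * (C * (1 - x)) ∧
      C' * x ^ (a + 1 - 1) * (1 - x) ^ (b - 1 - 1) = g * (C' * x) := by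
    intro x h0 h1
    have h1' : 0 < 1 - x := by linarith
    refine ⟨x ^ (a - 1) * (1 - x) ^ (b - 1 - 1), by positivity, ?_, ?_⟩
    · rw [Real.rpow_sub_one h1'.ne' (b - 1)]
      field_simp
    · rw [show a + 1 - 1 = (a - 1) + 1 by ring, Real.rpow_add_one h0.ne']
      ring
  have hsum : 0 < C + C' := by positivity
  -- The crossing point solves `C * (1 - x) = C' * x`.
  refine ⟨C / (C + C'), fun x hx => ?_, fun x hx => ?_⟩
  all_goals
    rw [betaPDF_eq, betaPDF_eq]
    split_ifs with h
    · obtain ⟨g, hg, e1, e2⟩ := key x h.1 h.2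
      apply ENNReal.ofReal_le_ofReal
      rw [e1, e2]
      refine mul_le_mul_of_nonneg_left ?_ hg
      first
        | rw [le_div_iff₀ hsum] at hx; nlinarith
        | rw [div_le_iff₀ hsum] at hx; nlinarith
    · exact le_rfl

/-- Single crossing gives stochastic dominance: left of the crossing integrate over `Iic t`, right
of it over the complement. -/
lemma cdf_betaMeasure_shift_le {a b : ℝ} (ha : 0 < a) (hb : 1 < b) (t : ℝ) :
    cdf (betaMeasure (a + 1) (b - 1)) t ≤ cdf (betaMeasure a b) t := by
  obtain ⟨c, h1, h2⟩ := betaPDF_le_betaPDF_shift ha hb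
  have i1 : IsProbabilityMeasure (betaMeasure a b) :=
    isProbabilityMeasureBeta ha (by linarith)
  have i2 : IsProbabilityMeasure (betaMeasure (a + 1) (b - 1)) :=
    isProbabilityMeasureBeta (by linarith) (by linarith)
  rw [cdf_eq_real, cdf_eq_real]
  rcases le_total t c with htc | htc
  · refine ENNReal.toReal_mono (measure_ne_top _ _) ?_
    rw [betaMeasure, betaMeasure, withDensity_apply _ measurableSet_Iic,
      withDensity_apply _ measurableSet_Iic]
    exact setLIntegral_mono' measurableSet_Iic fun x hx => h1 x (le_trans hx htc)
  · have h : (betaMeasure a b).real (Ioi t) ≤ (betaMeasure (a + 1) (b - 1)).real (Ioi t) := by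
      refine ENNReal.toReal_mono (measure_ne_top _ _) ?_
      rw [betaMeasure, betaMeasure, withDensity_apply _ measurableSet_Ioi,
        withDensity_apply _ measurableSet_Ioi]
      exact setLIntegral_mono' measurableSet_Ioi fun x hx => h2 x (htc.trans (le_of_lt hx))
    rw [← compl_Iic, probReal_compl_eq_one_sub measurableSet_Iic,
      probReal_compl_eq_one_sub measurableSet_Iic] at h
    linarith

lemma bddAbove_betaQuantile_set (F : ℝ → ℝ) (p : ℝ) :
    BddAbove {t : ℝ | t ∈ Icc (0 : ℝ) 1 ∧ F t ≤ p} :=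
  ⟨1, fun _ ht => ht.1.2⟩

lemma sSup_Icc_sublevel_mono {F G : ℝ → ℝ} {p r : ℝ} (h : ∀ t, F t ≤ p → G t ≤ r) :
    sSup {t : ℝ | t ∈ Icc (0 : ℝ) 1 ∧ F t ≤ p} ≤ sSup {t : ℝ | t ∈ Icc (0 : ℝ) 1 ∧ G t ≤ r} :=
  Real.sSup_le (fun _ ht => le_csSup (bddAbove_betaQuantile_set G r) ⟨ht.1, h _ ht.2⟩)
    (Real.sSup_nonneg fun _ ht => ht.1.1)

lemma betaQuantile_nonneg (k n : ℕ) (p : ℝ) : 0 ≤ betaQuantile k n p := by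
  unfold betaQuantile
  split_ifs
  · exact le_rfl
  · exact zero_le_one
  · exact Real.sSup_nonneg fun _ ht => ht.1.1

lemma betaQuantile_le_one (k n : ℕ) (p : ℝ) : betaQuantile k n p ≤ 1 := by
  unfold betaQuantile
  split_ifs
  · exact zero_le_one
  · exact le_rfl
  · exact Real.sSup_le (fun _ ht => ht.1.2) zero_le_one

lemma betaQuantile_mono_level (k n : ℕ) : Monotone (betaQuantile k n) := by
  intro p r hpr
  unfold betaQuantile
  split_ifs
  · exact le_rfl
  · exact le_rfl
  · exact sSup_Icc_sublevel_mono fun t ht => ht.trans hpr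

lemma betaQuantile_eq_one {k n : ℕ} (hk : k ≠ 0) {p : ℝ} (hp : 1 ≤ p) :
    betaQuantile k n p = 1 := by
  refine le_antisymm (betaQuantile_le_one _ _ _) ?_
  unfold betaQuantile
  rw [if_neg hk]
  split_ifs
  · exact le_rfl
  · exact le_csSup (bddAbove_betaQuantile_set _ p)
      ⟨⟨zero_le_one, le_rfl⟩, (cdf_le_one _ _).trans hp⟩

lemma betaQuantile_mono_rank (n : ℕ) (p : ℝ) : Monotone fun k => betaQuantile k n p := by
  refine monotone_nat_of_le_succ fun k => ?_
  rcases Nat.eq_zero_or_pos k with rfl | hk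
  · simpa [betaQuantile] using betaQuantile_nonneg (0 + 1) n p
  rcases Nat.lt_or_ge n (k + 1) with hn | hn
  · have : betaQuantile (k + 1) n p = 1 := by simp [betaQuantile, hn]
    rw [this]
    exact betaQuantile_le_one _ _ _
  · unfold betaQuantile
    rw [if_neg hk.ne', if_neg (by omega), if_neg (by omega), if_neg (by omega)]
    refine sSup_Icc_sublevel_mono fun t ht => le_trans ?_ ht
    have h := cdf_betaMeasure_shift_le (a := (k : ℝ)) (b := (n : ℝ) + 1 - k)
      (by exact_mod_cast hk) (by have : (k : ℝ) + 1 ≤ n := by exact_mod_cast hn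
                                 linarith) t
    have e : (n : ℝ) + 1 - ((k + 1 : ℕ) : ℝ) = n + 1 - k - 1 := by push_cast; ring
    rw [e]
    exact_mod_cast h

/-! ### Displaced rejections and calibration -/

/-- The lower band at count `k` lies above the upper band at count `l`. -/
def BandsSeparate (q : ℕ) (a : ℝ) (k l : ℕ) : Prop :=
  betaQuantile (l + 1) q (1 - a) < betaQuantile k q a

lemma BandsSeparate.mono {q : ℕ} {a b : ℝ} {k l k' l' : ℕ} (h : BandsSeparate q a k l)
    (hab : a ≤ b) (hk : k ≤ k') (hl : l' ≤ l) : BandsSeparate q b k' l' :=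
  calc betaQuantile (l' + 1) q (1 - b) ≤ betaQuantile (l + 1) q (1 - b) :=
        betaQuantile_mono_rank q _ (by omega)
    _ ≤ betaQuantile (l + 1) q (1 - a) := betaQuantile_mono_level _ _ (by linarith)
    _ < betaQuantile k q a := h
    _ ≤ betaQuantile k q b := betaQuantile_mono_level _ _ hab
    _ ≤ betaQuantile k' q b := betaQuantile_mono_rank q _ hk

/-- The upper band equals `1` here. This makes a nonpositive calibrated level harmless. -/
lemma not_bandsSeparate_of_nonpos {q : ℕ} {a : ℝ} (ha : a ≤ 0) (k l : ℕ) :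
    ¬ BandsSeparate q a k l := by
  intro h
  unfold BandsSeparate at h
  rw [betaQuantile_eq_one (Nat.succ_ne_zero l) (by linarith)] at h
  exact absurd (betaQuantile_le_one k q a) (not_le.2 h)

/-- A one-sided rejection in which the first sample is evaluated at `s + δ` and the second one
at `s - δ`. -/
def OneSidedReject {q : ℕ} (a δ : ℝ) (u v : Fin q → ℝ) : Prop :=
  ∃ s : ℝ, BandsSeparate q a (ecdfCount u (s + δ)) (ecdfCount v (s - δ))

/-- Rejection of some hypothesis of the family, up to a displacement `δ` of the samples. -/
def BlurredReject (H : NullFamily) {q : ℕ} (a δ : ℝ) (u v : Fin q → ℝ) : Prop :=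
  match H with
  | .eq => OneSidedReject a δ u v ∨ OneSidedReject a δ v u
  | .le => OneSidedReject a δ u v
  | .ge => OneSidedReject a δ v u

lemma rejects_iff (H : NullFamily) {q : ℕ} (a : ℝ) (u v : Fin q → ℝ) (r : ℝ) :
    Rejects H a u v r ↔ match H with
      | .eq => BandsSeparate q a (ecdfCount u r) (ecdfCount v r) ∨
          BandsSeparate q a (ecdfCount v r) (ecdfCount u r)
      | .le => BandsSeparate q a (ecdfCount u r) (ecdfCount v r)
      | .ge => BandsSeparate q a (ecdfCount v r) (ecdfCount u r) := by
  cases H <;> rfl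

lemma exists_rejects_iff (H : NullFamily) {q : ℕ} (a : ℝ) (u v : Fin q → ℝ) :
    (∃ r, Rejects H a u v r) ↔ BlurredReject H a 0 u v := by
  cases H <;> simp [rejects_iff, BlurredReject, OneSidedReject, exists_or]

lemma ecdfCount_mono {n : ℕ} (v : Fin n → ℝ) : Monotone (ecdfCount v) := fun _ _ h =>
  Finset.card_le_card (Finset.monotone_filter_right _ fun _ _ hi => hi.trans h)

lemma OneSidedReject.mono {q : ℕ} {a b δ ε : ℝ} {u v : Fin q → ℝ} (h : OneSidedReject a δ u v)
    (hab : a ≤ b) (hδ : δ ≤ ε) : OneSidedReject b ε u v := by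
  obtain ⟨s, hs⟩ := h
  exact ⟨s, hs.mono hab (ecdfCount_mono _ (by linarith)) (ecdfCount_mono _ (by linarith))⟩

lemma BlurredReject.mono {H : NullFamily} {q : ℕ} {a b δ ε : ℝ} {u v : Fin q → ℝ}
    (h : BlurredReject H a δ u v) (hab : a ≤ b) (hδ : δ ≤ ε) : BlurredReject H b ε u v := by
  cases H
  · exact h.imp (fun h => h.mono hab hδ) fun h => h.mono hab hδ
  · exact OneSidedReject.mono h hab hδ
  · exact OneSidedReject.mono h hab hδ

lemma not_blurredReject_of_nonpos {H : NullFamily} {q : ℕ} {a δ : ℝ} (ha : a ≤ 0)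
    (u v : Fin q → ℝ) : ¬ BlurredReject H a δ u v := by
  have h : ∀ w z : Fin q → ℝ, ¬ OneSidedReject a δ w z := fun w z ⟨_, hs⟩ =>
    not_bandsSeparate_of_nonpos ha _ _ hs
  cases H
  · exact fun h' => h'.elim (h u v) (h v u)
  · exact h u v
  · exact h v u

lemma unifFWER_eq (H : NullFamily) (q : ℕ) (a : ℝ) :
    unifFWER H q q a =
      ((unifSample q).prod (unifSample q)) {p | BlurredReject H a 0 p.1 p.2} := by
  simp only [unifFWER, exists_rejects_iff]

/-- The supremum need not be attained, but subtracting `1 / 10000` puts the level strictly below it,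
hence below an admissible level; rejections are monotone in the level. -/
lemma unifFWER_calibratedLevel_le (H : NullFamily) (q : ℕ) (α : ℝ) :
    unifFWER H q q (calibratedLevel H q q α) ≤ ENNReal.ofReal α := by
  rcases le_or_gt (calibratedLevel H q q α) 0 with h | h
  · rw [unifFWER_eq]
    simp [not_blurredReject_of_nonpos h]
  · set S := {a : ℝ | a ∈ Ioo (0 : ℝ) 1 ∧ unifFWER H q q a ≤ ENNReal.ofReal α} with hS
    have hlt : calibratedLevel H q q α < sSup S := by
      rw [calibratedLevel, ← hS]
      linarith
    -- For empty `S` the supremum defaults to `0`, which would make the level negative.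
    have hne : S.Nonempty := by
      by_contra hn
      rw [not_nonempty_iff_eq_empty] at hn
      rw [hn, Real.sSup_empty] at hlt
      linarith
    obtain ⟨b, hb, hlb⟩ := exists_lt_of_lt_csSup hne hlt
    refine le_trans ?_ hb.2
    rw [unifFWER_eq, unifFWER_eq]
    exact measure_mono fun p hp => BlurredReject.mono hp hlb.le le_rfl

/-! ### Measurability and continuity in the displacement -/

/-- Right-continuity of the step function; it lets existential quantifiers over `r` be restricted to
countable sets. -/
lemma eventually_ecdfCount_eq {n : ℕ} (v : Fin n → ℝ) (r : ℝ) :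
    ∃ ε > 0, ∀ s, r ≤ s → s < r + ε → ecdfCount v s = ecdfCount v r := by
  have h : ∀ᶠ s in 𝓝 r, ∀ i, r < v i → s < v i := by
    refine eventually_all.2 fun i => ?_
    by_cases hi : r < v i
    · filter_upwards [eventually_lt_nhds hi] with s hs _ using hs
    · exact Eventually.of_forall fun _ h => absurd h hi
  obtain ⟨ε, hε, hb⟩ := Metric.eventually_nhds_iff.1 h
  refine ⟨ε, hε, fun s hs hs' => ?_⟩
  have hs2 := hb (y := s) (by rw [Real.dist_eq, abs_of_nonneg (by linarith)]; linarith)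
  unfold ecdfCount
  congr 1
  refine Finset.filter_congr fun i _ => ⟨fun hi => ?_, fun hi => hi.trans hs⟩
  by_contra hc
  exact absurd (hs2 i (not_le.1 hc)) (not_lt.2 hi)

lemma measurable_ecdfCount (n : ℕ) (r : ℝ) :
    Measurable fun v : Fin n → ℝ => ecdfCount v r := by
  simp only [ecdfCount, Finset.card_filter]
  refine Finset.measurable_sum _ fun i _ => ?_
  exact Measurable.ite (measurableSet_le (measurable_pi_apply i) measurable_const)
    measurable_const measurable_const

/-- Every set of reals has a countable subset that is dense in it from the right. -/
lemma exists_countable_rightDense (T : Set ℝ) :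
    ∃ D ⊆ T, D.Countable ∧ ∀ r ∈ T, ∀ ε > 0, ∃ d ∈ D, r ≤ d ∧ d < r + ε := by
  classical
  let I : Set (ℚ × ℚ) := {p | (T ∩ Ioo (p.1 : ℝ) p.2).Nonempty}
  have hI : ∀ p : I, ∃ d, d ∈ T ∩ Ioo (p.1.1 : ℝ) p.1.2 := fun p => p.2
  choose f hf using hI
  -- Points of `T` isolated from the right are countably many and are all kept; the others are
  -- approached by one chosen point per rational interval meeting `T`.
  refine ⟨{x ∈ T | 𝓝[T ∩ Ioi x] x = ⊥} ∪ range f, ?_,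
    countable_setOfPred_isolated_right_within.union (countable_range f), fun r hr ε hε => ?_⟩
  · rintro x (hx | ⟨p, rfl⟩)
    · exact hx.1
    · exact (hf p).1
  · by_cases h : T ∩ Ioo r (r + ε) = ∅
    · refine ⟨r, Or.inl ⟨hr, ?_⟩, le_rfl, by linarith⟩
      rw [← empty_mem_iff_bot, ← h]
      filter_upwards [self_mem_nhdsWithin, mem_nhdsWithin_of_mem_nhds
        (Iio_mem_nhds (show r < r + ε by linarith))] with t ht ht'
      exact ⟨ht.1, ht.2, ht'⟩
    · obtain ⟨t, ht, h1, h2⟩ := nonempty_iff_ne_empty.2 h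
      obtain ⟨p, hp1, hp2⟩ := exists_rat_btwn h1
      obtain ⟨p', hp1', hp2'⟩ := exists_rat_btwn h2
      have hd := hf ⟨(p, p'), ⟨t, ht, hp2, hp1'⟩⟩
      exact ⟨_, Or.inr (mem_range_self _), (hp1.trans hd.2.1).le, hd.2.2.trans hp2'⟩

lemma measurableSet_oneSidedReject (q : ℕ) (a δ : ℝ) :
    MeasurableSet {p : (Fin q → ℝ) × (Fin q → ℝ) | OneSidedReject a δ p.1 p.2} := by
  obtain ⟨D, -, hD, hd⟩ := exists_countable_rightDense univ
  have : {p : (Fin q → ℝ) × (Fin q → ℝ) | OneSidedReject a δ p.1 p.2} =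
      ⋃ s ∈ D, {p | BandsSeparate q a (ecdfCount p.1 (s + δ)) (ecdfCount p.2 (s - δ))} := by
    ext ⟨u, v⟩
    simp only [mem_ofPred_eq, mem_iUnion, exists_prop]
    constructor
    · rintro ⟨s, hs⟩
      obtain ⟨ε₁, h₁, he₁⟩ := eventually_ecdfCount_eq u (s + δ)
      obtain ⟨ε₂, h₂, he₂⟩ := eventually_ecdfCount_eq v (s - δ)
      obtain ⟨d, hdD, hd1, hd2⟩ := hd s (mem_univ s) (min ε₁ ε₂) (lt_min h₁ h₂)
      have := min_le_left ε₁ ε₂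
      have := min_le_right ε₁ ε₂
      refine ⟨d, hdD, ?_⟩
      rw [he₁ (d + δ) (by linarith) (by linarith), he₂ (d - δ) (by linarith) (by linarith)]
      exact hs
    · rintro ⟨s, -, hs⟩
      exact ⟨s, hs⟩
  rw [this]
  refine MeasurableSet.biUnion hD fun s _ => ?_
  have hm : Measurable fun p : (Fin q → ℝ) × (Fin q → ℝ) =>
      (ecdfCount p.1 (s + δ), ecdfCount p.2 (s - δ)) :=
    ((measurable_ecdfCount q _).comp measurable_fst).prodMk
      ((measurable_ecdfCount q _).comp measurable_snd)
  exact hm (MeasurableSet.of_discrete (s := {c : ℕ × ℕ | BandsSeparate q a c.1 c.2}))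

lemma measurableSet_blurredReject (H : NullFamily) (q : ℕ) (a δ : ℝ) :
    MeasurableSet {p : (Fin q → ℝ) × (Fin q → ℝ) | BlurredReject H a δ p.1 p.2} := by
  have h1 := measurableSet_oneSidedReject q a δ
  have h2 : MeasurableSet {p : (Fin q → ℝ) × (Fin q → ℝ) | OneSidedReject a δ p.2 p.1} :=
    measurable_swap h1
  cases H
  · exact h1.union h2
  · exact h1
  · exact h2

lemma ecdfCount_eq_of_forall_notMem {n : ℕ} {v : Fin n → ℝ} {r s : ℝ} (hrs : r ≤ s)
    (h : ∀ i, v i ∉ Ioc r s) : ecdfCount v r = ecdfCount v s := by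
  unfold ecdfCount
  congr 1
  refine Finset.filter_congr fun i _ => ⟨fun hi => hi.trans hrs, fun hi => ?_⟩
  by_contra hc
  exact h i ⟨not_le.1 hc, hi⟩

/-- The half-open interval `Ioc (s - δ) (s + δ)` cannot contain points of both samples. The sample
that misses it has equal counts at both ends, so both samples can be evaluated at a common end. -/
lemma OneSidedReject.of_separated {q : ℕ} {a δ : ℝ} {u v : Fin q → ℝ} (hδ : 0 ≤ δ)
    (h : OneSidedReject a δ u v) (hsep : ∀ i j, 2 * δ ≤ |u i - v j|) :
    OneSidedReject a 0 u v := by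
  obtain ⟨s, hs⟩ := h
  by_cases hv : ∀ j, v j ∉ Ioc (s - δ) (s + δ)
  · refine ⟨s + δ, ?_⟩
    rw [ecdfCount_eq_of_forall_notMem (by linarith) hv] at hs
    simpa using hs
  · push Not at hv
    obtain ⟨j, hj⟩ := hv
    have hu : ∀ i, u i ∉ Ioc (s - δ) (s + δ) := fun i hi => by
      have h1 : |u i - v j| < 2 * δ := abs_lt.2 ⟨by linarith [hi.1, hj.2], by linarith [hi.2, hj.1]⟩
      linarith [hsep i j]
    refine ⟨s - δ, ?_⟩
    rw [← ecdfCount_eq_of_forall_notMem (by linarith) hu] at hs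
    simpa using hs

lemma BlurredReject.of_separated {H : NullFamily} {q : ℕ} {a δ : ℝ} {u v : Fin q → ℝ}
    (hδ : 0 ≤ δ) (h : BlurredReject H a δ u v) (hsep : ∀ i j, 2 * δ ≤ |u i - v j|) :
    BlurredReject H a 0 u v := by
  have hsep' : ∀ i j, 2 * δ ≤ |v i - u j| := fun i j => abs_sub_comm (v i) (u j) ▸ hsep j i
  cases H
  · exact h.imp (fun h => h.of_separated hδ hsep) fun h => h.of_separated hδ hsep'
  · exact OneSidedReject.of_separated hδ h hsep
  · exact OneSidedReject.of_separated hδ h hsep'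

/-- The uniform distribution on the unit interval. -/
noncomputable abbrev unif : Measure ℝ := (volume : Measure ℝ).restrict (Icc 0 1)

instance isProbabilityMeasure_unif : IsProbabilityMeasure unif :=
  ⟨by simp [unif]⟩

instance isProbabilityMeasure_unifSample (n : ℕ) : IsProbabilityMeasure (unifSample n) := by
  unfold unifSample
  infer_instance

lemma unifSample_prod_tie (m n : ℕ) :
    ((unifSample m).prod (unifSample n))
      {p : (Fin m → ℝ) × (Fin n → ℝ) | ∃ i j, p.1 i = p.2 j} = 0 := by
  have : {p : (Fin m → ℝ) × (Fin n → ℝ) | ∃ i j, p.1 i = p.2 j} =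
      ⋃ i, ⋃ j, {p | p.1 i = p.2 j} := by
    ext p
    simp
  rw [this]
  refine measure_iUnion_null fun i => measure_iUnion_null fun j => ?_
  rw [Measure.measure_prod_null (measurableSet_eq_fun (by fun_prop) (by fun_prop))]
  refine Eventually.of_forall fun u => ?_
  have h : (Prod.mk u ⁻¹' {p : (Fin m → ℝ) × (Fin n → ℝ) | p.1 i = p.2 j}) =
      {v | v j = u i} := by
    ext v
    simp [eq_comm]
  change unifSample n _ = 0
  rw [h]
  exact Measure.pi_hyperplane (fun _ => unif) j (u i)

/-- The probability of a displaced rejection is right-continuous in the displacement at `0`. -/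
lemma le_unifFWER_of_forall_le_blurred (H : NullFamily) (q : ℕ) (a : ℝ) {x : ℝ≥0∞}
    (h : ∀ δ : ℝ, 0 < δ →
      x ≤ ((unifSample q).prod (unifSample q)) {p | BlurredReject H a δ p.1 p.2}) :
    x ≤ unifFWER H q q a := by
  set ρ := (unifSample q).prod (unifSample q)
  have hlim := tendsto_measure_iInter_atTop (μ := ρ)
    (s := fun m : ℕ => {p : (Fin q → ℝ) × (Fin q → ℝ) |
      BlurredReject H a (1 / ((m : ℝ) + 1)) p.1 p.2})
    (fun m => (measurableSet_blurredReject H q a _).nullMeasurableSet)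
    (fun m n hmn p hp => BlurredReject.mono hp le_rfl
      (one_div_le_one_div_of_le (by positivity) (by gcongr)))
    ⟨0, measure_ne_top _ _⟩
  have h1 := ge_of_tendsto hlim (b := x) (Eventually.of_forall fun m => h _ (by positivity))
  refine h1.trans ?_
  rw [unifFWER_eq]
  -- Without cross-sample ties the finitely many distances are bounded below by a positive number,
  -- so a small enough displacement can be removed.
  have hsub : (⋂ m : ℕ, {p : (Fin q → ℝ) × (Fin q → ℝ) |
      BlurredReject H a (1 / ((m : ℝ) + 1)) p.1 p.2}) ⊆
      {p | BlurredReject H a 0 p.1 p.2} ∪ {p | ∃ i j, p.1 i = p.2 j} := by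
    intro p hp
    by_cases ht : ∃ i j, p.1 i = p.2 j
    · exact Or.inr ht
    · left
      push Not at ht
      have hev : ∀ᶠ m : ℕ in atTop, ∀ i j, 2 * (1 / ((m : ℝ) + 1)) ≤ |p.1 i - p.2 j| := by
        refine eventually_all.2 fun i => eventually_all.2 fun j => ?_
        have hpos : 0 < |p.1 i - p.2 j| := abs_pos.2 (sub_ne_zero.2 (ht i j))
        have := (tendsto_one_div_add_atTop_nhds_zero_nat (𝕜 := ℝ)).const_mul 2
        rw [mul_zero] at this
        exact (this.eventually_lt_const hpos).mono fun _ h => h.le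
      obtain ⟨m, hm⟩ := hev.exists
      exact BlurredReject.of_separated (by positivity) (mem_iInter.1 hp m) hm
  refine (measure_mono hsub).trans ((measure_union_le _ _).trans ?_)
  rw [unifSample_prod_tie, add_zero]

/-! ### Representation of the sample by independent uniform variables -/

open Classical in
/-- The quantile function of the conditional distribution given `x`, at levels in `(0, 1)`. -/
noncomputable def condQuantile (κ : Kernel ℝ ℝ) (x u : ℝ) : ℝ :=
  if u ∈ Ioo (0 : ℝ) 1 then sInf {y : ℝ | u ≤ condF κ y x} else 0

lemma condQuantile_le_iff (κ : Kernel ℝ ℝ) (x : ℝ) {u : ℝ} (hu : u ∈ Ioo (0 : ℝ) 1) (r : ℝ) :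
    condQuantile κ x u ≤ r ↔ u ≤ condF κ r x := by
  have hbdd : BddBelow {y : ℝ | u ≤ condF κ y x} := by
    obtain ⟨b, hb⟩ := ((tendsto_cdf_atBot (κ x)).eventually_lt_const hu.1).exists
    refine ⟨b, fun y hy => ?_⟩
    by_contra hc
    exact absurd (hy.trans (monotone_cdf (κ x) (not_le.1 hc).le)) (not_le.2 hb)
  have hne : {y : ℝ | u ≤ condF κ y x}.Nonempty := by
    obtain ⟨b, hb⟩ := ((tendsto_cdf_atTop (κ x)).eventually_const_lt hu.2).exists
    exact ⟨b, hb.le⟩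
  rw [condQuantile, if_pos hu]
  refine ⟨fun h => ?_, fun h => csInf_le hbdd h⟩
  -- Right-continuity handles the case in which `r` is the infimum itself.
  refine ge_of_tendsto (((cdf (κ x)).right_continuous r).tendsto.mono_left
    (nhdsWithin_mono r Ioi_subset_Ici_self)) ?_
  filter_upwards [self_mem_nhdsWithin] with y hy
  obtain ⟨z, hz, hzy⟩ := exists_lt_of_csInf_lt hne (lt_of_le_of_lt h hy)
  exact le_trans hz (monotone_cdf (κ x) hzy.le)

lemma measurable_condF (κ : Kernel ℝ ℝ) [IsMarkovKernel κ] (r : ℝ) : Measurable (condF κ r) := by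
  have : condF κ r = fun x => (κ x (Iic r)).toReal := by
    ext x
    exact cdf_eq_real (κ x) r
  rw [this]
  exact (κ.measurable_coe measurableSet_Iic).ennreal_toReal

lemma measurable_condQuantile (κ : Kernel ℝ ℝ) [IsMarkovKernel κ] :
    Measurable fun p : ℝ × ℝ => condQuantile κ p.1 p.2 := by
  refine measurable_of_Iic fun r => ?_
  have : (fun p : ℝ × ℝ => condQuantile κ p.1 p.2) ⁻¹' Iic r =
      ({p | p.2 ∈ Ioo (0 : ℝ) 1} ∩ {p | p.2 ≤ condF κ r p.1}) ∪
        ({p | p.2 ∈ Ioo (0 : ℝ) 1}ᶜ ∩ {_p | 0 ≤ r}) := by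
    ext p
    by_cases hp : p.2 ∈ Ioo (0 : ℝ) 1
    · simp only [mem_preimage, mem_Iic, condQuantile_le_iff κ p.1 hp, mem_union, mem_inter_iff,
        mem_compl_iff, mem_ofPred_eq, hp, true_and, not_true, false_and, or_false]
    · simp only [mem_preimage, mem_Iic, condQuantile, hp, if_false, mem_union, mem_inter_iff,
        mem_compl_iff, mem_ofPred_eq, false_and, not_false_iff, true_and, false_or]
  rw [this]
  have h1 : MeasurableSet {p : ℝ × ℝ | p.2 ∈ Ioo (0 : ℝ) 1} := measurable_snd measurableSet_Ioo
  exact (h1.inter (measurableSet_le measurable_snd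
    ((measurable_condF κ r).comp measurable_fst))).union (h1.compl.inter (MeasurableSet.const _))

lemma ae_unif_mem_Ioo : ∀ᵐ u ∂unif, u ∈ Ioo (0 : ℝ) 1 := by
  rw [unif, ← restrict_Ioo_eq_restrict_Icc]
  exact ae_restrict_mem measurableSet_Ioo

lemma map_condQuantile_unif (κ : Kernel ℝ ℝ) [IsMarkovKernel κ] (x : ℝ) :
    unif.map (condQuantile κ x) = κ x := by
  have hm : Measurable (condQuantile κ x) :=
    (measurable_condQuantile κ).comp measurable_prodMk_left
  have : IsProbabilityMeasure (unif.map (condQuantile κ x)) :=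
    Measure.isProbabilityMeasure_map hm.aemeasurable
  refine Measure.ext_of_Iic _ _ fun r => ?_
  rw [Measure.map_apply hm measurableSet_Iic, ← ofReal_cdf]
  have h : condQuantile κ x ⁻¹' Iic r =ᵐ[unif] Iic (condF κ r x) := by
    filter_upwards [ae_unif_mem_Ioo] with u hu
    exact propext (condQuantile_le_iff κ x hu r)
  rw [measure_congr h, Measure.restrict_apply measurableSet_Iic]
  have : Iic (condF κ r x) ∩ Icc 0 1 = Icc 0 (condF κ r x) := by
    ext u
    have := cdf_le_one (κ x) r
    simp only [mem_inter_iff, mem_Iic, mem_Icc, condF]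
    constructor
    · rintro ⟨h1, h2, -⟩
      exact ⟨h2, h1⟩
    · rintro ⟨h1, h2⟩
      exact ⟨h2, h1, h2.trans this⟩
  rw [this, Real.volume_Icc, sub_zero, condF]

/-- Inverse transform in each fibre, with the same uniform law over every `x`: this is what makes
the uniform independent of the running variable. -/
lemma compProd_eq_map_condQuantile (PX : Measure ℝ) [IsProbabilityMeasure PX] (κ : Kernel ℝ ℝ)
    [IsMarkovKernel κ] :
    PX.compProd κ = (PX.prod unif).map fun p => (p.1, condQuantile κ p.1 p.2) := by
  have hm : Measurable fun p : ℝ × ℝ => (p.1, condQuantile κ p.1 p.2) :=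
    measurable_fst.prodMk (measurable_condQuantile κ)
  ext s hs
  rw [Measure.compProd_apply hs, Measure.map_apply hm hs, Measure.prod_apply (hm hs)]
  refine lintegral_congr fun x => ?_
  have hmx : Measurable (condQuantile κ x) :=
    (measurable_condQuantile κ).comp measurable_prodMk_left
  rw [← map_condQuantile_unif κ x, Measure.map_apply hmx (measurable_prodMk_left hs)]
  rfl

/-- Separates all running variables from all uniforms, so that Fubini can fix the former. On finite
cylinders the integral factors by independence of the coordinates. -/
lemma map_zip_prod_infinitePi {ι α β : Type*} [MeasurableSpace α] [MeasurableSpace β]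
    (μ : Measure α) [IsProbabilityMeasure μ] (ν : Measure β) [IsProbabilityMeasure ν] :
    ((Measure.infinitePi fun _ : ι => μ).prod (Measure.infinitePi fun _ : ι => ν)).map
      (fun p i => (p.1 i, p.2 i)) = Measure.infinitePi fun _ : ι => μ.prod ν := by
  have hm : Measurable fun (p : (ι → α) × (ι → β)) (i : ι) => (p.1 i, p.2 i) := by fun_prop
  refine Measure.eq_infinitePi _ fun s t ht => ?_
  have hs : MeasurableSet (Set.pi (s : Set ι) t) :=
    MeasurableSet.pi s.countable_toSet fun i _ => ht i
  rw [Measure.map_apply hm hs, Measure.prod_apply (hm hs)]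
  have h1 : ∀ x : ι → α, (Measure.infinitePi fun _ : ι => ν)
      (Prod.mk x ⁻¹' ((fun (p : (ι → α) × (ι → β)) (i : ι) => (p.1 i, p.2 i)) ⁻¹'
        Set.pi (s : Set ι) t)) = ∏ i ∈ s, ν (Prod.mk (x i) ⁻¹' t i) := fun x => by
    rw [← Measure.infinitePi_pi (fun _ : ι => ν) fun i _ => measurable_prodMk_left (ht i)]
    rfl
  simp_rw [h1]
  have hmt : ∀ i, Measurable fun a : α => ν (Prod.mk a ⁻¹' t i) := fun i =>
    measurable_measure_prodMk_left (ht i)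
  rw [lintegral_prod_eq_prod_lintegral_of_indepFun s
    (fun i (x : ι → α) => ν (Prod.mk (x i) ⁻¹' t i))
    (iIndepFun_infinitePi (P := fun _ : ι => μ) (X := fun i a => ν (Prod.mk a ⁻¹' t i)) hmt)
    fun i => (hmt i).comp (measurable_pi_apply i)]
  refine Finset.prod_congr rfl fun i _ => ?_
  rw [Measure.prod_apply (ht i), ← (measurePreserving_eval_infinitePi (fun _ : ι => μ) i).map_eq,
    lintegral_map (hmt i) (measurable_pi_apply i)]
  simp [Measure.infinitePi_map_eval]

/-- The law of an iid sample of pairs, with the outcomes generated from uniform variables that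
are independent of the running variables. -/
lemma map_sample_eq {Ω : Type*} [MeasurableSpace Ω] (P : Measure Ω) [IsProbabilityMeasure P]
    (X Y : ℕ → Ω → ℝ) (hX : ∀ i, Measurable (X i)) (hY : ∀ i, Measurable (Y i))
    (hindep : iIndepFun (fun i ω => (X i ω, Y i ω)) P)
    (hident : ∀ i, IdentDistrib (fun ω => (X i ω, Y i ω)) (fun ω => (X 0 ω, Y 0 ω)) P P)
    (κ : Kernel ℝ ℝ) [IsMarkovKernel κ]
    (hκ : (P.map (X 0)).compProd κ = P.map (fun ω => (X 0 ω, Y 0 ω))) :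
    P.map (fun ω => (fun i => X i ω, fun i => Y i ω)) =
      ((Measure.infinitePi fun _ : ℕ => P.map (X 0)).prod
        (Measure.infinitePi fun _ : ℕ => unif)).map
        fun p => (p.1, fun i => condQuantile κ (p.1 i) (p.2 i)) := by
  have hPX : IsProbabilityMeasure (P.map (X 0)) :=
    Measure.isProbabilityMeasure_map (hX 0).aemeasurable
  have hφ : Measurable fun p : ℝ × ℝ => (p.1, condQuantile κ p.1 p.2) :=
    measurable_fst.prodMk (measurable_condQuantile κ)
  have hZ : ∀ i, Measurable fun ω => (X i ω, Y i ω) := fun i => (hX i).prodMk (hY i)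
  have h1 := (iIndepFun_iff_map_fun_eq_infinitePi_map hZ).1 hindep
  have hun : Measurable fun z : ℕ → ℝ × ℝ => (fun i => (z i).1, fun i => (z i).2) := by fun_prop
  have h2 : ∀ i, P.map (fun ω => (X i ω, Y i ω)) =
      ((P.map (X 0)).prod unif).map fun p => (p.1, condQuantile κ p.1 p.2) := fun i => by
    rw [(hident i).map_eq, ← hκ, compProd_eq_map_condQuantile]
  simp_rw [h2] at h1
  have hψ : Measurable fun (z : ℕ → ℝ × ℝ) (i : ℕ) => ((z i).1, condQuantile κ (z i).1 (z i).2) :=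
    measurable_pi_lambda _ fun i => hφ.comp (measurable_pi_apply i)
  have h3 := Measure.infinitePi_map_pi (fun _ : ℕ => (P.map (X 0)).prod unif)
    (f := fun _ p => (p.1, condQuantile κ p.1 p.2)) fun _ => hφ
  rw [← h3, ← map_zip_prod_infinitePi] at h1
  have h4 := congrArg (fun μ => μ.map fun z : ℕ → ℝ × ℝ => (fun i => (z i).1, fun i => (z i).2)) h1
  rw [Measure.map_map hun (measurable_pi_lambda _ hZ), Measure.map_map hun hψ,
    Measure.map_map (hun.comp hψ) (by fun_prop)] at h4
  exact h4

/-! ### The observations nearest the cutoff -/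

section Rank

variable {S : Finset ℕ} {R : ℕ → ℕ → Prop} [∀ i k, Decidable (R i k)]

lemma card_filter_rel_lt (hirr : ∀ i, ¬ R i i) (htrans : ∀ i j k, R i j → R j k → R i k)
    {i k : ℕ} (hi : i ∈ S) (h : R i k) : (S.filter (R · i)).card < (S.filter (R · k)).card := by
  refine Finset.card_lt_card (Finset.ssubset_iff_of_subset
    (Finset.monotone_filter_right _ fun j _ hj => htrans j i k hj h) |>.2 ⟨i, ?_, ?_⟩)
  · exact Finset.mem_filter.2 ⟨hi, h⟩
  · exact fun hc => hirr i (Finset.mem_filter.1 hc).2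

lemma card_filter_rel_injOn (hirr : ∀ i, ¬ R i i) (htrans : ∀ i j k, R i j → R j k → R i k)
    (htri : ∀ i j, R i j ∨ i = j ∨ R j i) :
    Set.InjOn (fun k => (S.filter (R · k)).card) S := by
  intro i hi k hk h
  rcases htri i k with h' | h' | h'
  · exact absurd h (card_filter_rel_lt hirr htrans hi h').ne
  · exact h'
  · exact absurd h (card_filter_rel_lt hirr htrans hk h').ne'

/-- Pigeonhole: ranks are injective on `S` and smaller than `S.card`, so every such value occurs. -/
lemma exists_card_filter_rel_eq (hirr : ∀ i, ¬ R i i)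
    (htrans : ∀ i j k, R i j → R j k → R i k) (htri : ∀ i j, R i j ∨ i = j ∨ R j i)
    {j : ℕ} (hj : j < S.card) : ∃ k ∈ S, (S.filter (R · k)).card = j := by
  have himg : S.image (fun k => (S.filter (R · k)).card) = Finset.range S.card := by
    refine Finset.eq_of_subset_of_card_le (fun r hr => ?_) ?_
    · obtain ⟨k, hk, rfl⟩ := Finset.mem_image.1 hr
      refine Finset.mem_range.2 (Finset.card_lt_card ?_)
      exact Finset.filter_ssubset.2 ⟨k, hk, hirr k⟩
    · rw [Finset.card_image_of_injOn (card_filter_rel_injOn hirr htrans htri), Finset.card_range]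
  exact Finset.mem_image.1 (himg ▸ Finset.mem_range.2 hj)

/-- The first `q` elements of `S`, all of which lie in an initial part `W` with at least `q`
elements. -/
lemma exists_order_statistics (hirr : ∀ i, ¬ R i i)
    (htrans : ∀ i j k, R i j → R j k → R i k) (htri : ∀ i j, R i j ∨ i = j ∨ R j i)
    {W : Finset ℕ} (hWS : W ⊆ S) (hW : ∀ i ∈ W, ∀ k ∈ S, k ∉ W → R i k)
    {q : ℕ} (hq : q ≤ W.card) :
    ∃ σ : Fin q → ℕ, Function.Injective σ ∧ (∀ j, σ j ∈ W) ∧ ∀ (y : ℕ → ℝ) (j : Fin q),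
      ∑ k ∈ S.filter (fun k => (S.filter (R · k)).card = (j : ℕ)), y k = y (σ j) := by
  have h : ∀ j : Fin q, ∃ k ∈ S, (S.filter (R · k)).card = (j : ℕ) := fun j =>
    exists_card_filter_rel_eq hirr htrans htri
      (j.2.trans_le (hq.trans (Finset.card_le_card hWS)))
  choose σ hσS hσ using h
  refine ⟨σ, fun i j hij => ?_, fun j => ?_, fun y j => ?_⟩
  · have := hσ i
    rw [hij, hσ j] at this
    exact Fin.ext this.symm
  · by_contra hc
    -- An element outside `W` is preceded by all of `W`, so its rank is at least `q`.
    have hsub : W ⊆ S.filter (R · (σ j)) := fun i hi =>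
      Finset.mem_filter.2 ⟨hWS hi, hW i hi _ (hσS j) hc⟩
    have := Finset.card_le_card hsub
    rw [hσ j] at this
    exact absurd (hq.trans this) (not_le.2 j.2)
  · have : S.filter (fun k => (S.filter (R · k)).card = (j : ℕ)) = {σ j} := by
      ext k
      rw [Finset.mem_filter, Finset.mem_singleton]
      constructor
      · rintro ⟨hk, hkj⟩
        exact card_filter_rel_injOn hirr htrans htri hk (hσS j) (hkj.trans (hσ j).symm)
      · rintro rfl
        exact ⟨hσS j, hσ j⟩
    rw [this, Finset.sum_singleton]

end Rank

lemma mem_obsIn {n : ℕ} {x : ℕ → ℝ} {S : Set ℝ} {k : ℕ} :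
    k ∈ obsIn n x S ↔ k < n ∧ x k ∈ S := by
  simp [obsIn]

lemma obsIn_mono {n : ℕ} {x : ℕ → ℝ} {S T : Set ℝ} (h : S ⊆ T) : obsIn n x S ⊆ obsIn n x T :=
  fun _ hk => mem_obsIn.2 ⟨(mem_obsIn.1 hk).1, h (mem_obsIn.1 hk).2⟩

/-- The indices `σ` are chosen before `y`: the same selection applies to the outcomes and to the
uniforms generating them. -/
lemma exists_leftSample_eq {x₀ xl : ℝ} {q n : ℕ} {x : ℕ → ℝ}
    (hq : q ≤ (obsIn n x (Ico xl x₀)).card) :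
    ∃ σ : Fin q → ℕ, Function.Injective σ ∧ (∀ j, x (σ j) ∈ Ico xl x₀) ∧
      ∀ y, leftSample x₀ q n x y = fun j => y (σ j) := by
  have hW : ∀ i ∈ obsIn n x (Ico xl x₀), ∀ k ∈ obsIn n x (Iio x₀), k ∉ obsIn n x (Ico xl x₀) →
      x k < x i ∨ (x i = x k ∧ i < k) := by
    intro i hi k hk hkW
    have hkl : x k < xl := by
      by_contra hc
      exact hkW (mem_obsIn.2 ⟨(mem_obsIn.1 hk).1, not_lt.1 hc, (mem_obsIn.1 hk).2⟩)
    exact Or.inl (hkl.trans_le (mem_obsIn.1 hi).2.1)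
  obtain ⟨σ, h1, h2, h3⟩ := exists_order_statistics
    (S := obsIn n x (Iio x₀)) (R := fun i k => x k < x i ∨ (x i = x k ∧ i < k))
    (W := obsIn n x (Ico xl x₀)) (by simp) (by grind) (by grind)
    (obsIn_mono fun t ht => ht.2) hW hq
  exact ⟨σ, h1, fun j => (mem_obsIn.1 (h2 j)).2, fun y => funext fun j => h3 y j⟩

lemma exists_rightSample_eq {x₀ xu : ℝ} {q n : ℕ} {x : ℕ → ℝ}
    (hq : q ≤ (obsIn n x (Icc x₀ xu)).card) :
    ∃ τ : Fin q → ℕ, Function.Injective τ ∧ (∀ j, x (τ j) ∈ Icc x₀ xu) ∧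
      ∀ y, rightSample x₀ q n x y = fun j => y (τ j) := by
  have hW : ∀ i ∈ obsIn n x (Icc x₀ xu), ∀ k ∈ obsIn n x (Ici x₀), k ∉ obsIn n x (Icc x₀ xu) →
      x i < x k ∨ (x i = x k ∧ i < k) := by
    intro i hi k hk hkW
    have hkl : xu < x k := by
      by_contra hc
      exact hkW (mem_obsIn.2 ⟨(mem_obsIn.1 hk).1, (mem_obsIn.1 hk).2, not_lt.1 hc⟩)
    exact Or.inl ((mem_obsIn.1 hi).2.2.trans_lt hkl)
  obtain ⟨τ, h1, h2, h3⟩ := exists_order_statistics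
    (S := obsIn n x (Ici x₀)) (R := fun i k => x i < x k ∨ (x i = x k ∧ i < k))
    (W := obsIn n x (Icc x₀ xu)) (by simp) (by grind) (by grind)
    (obsIn_mono fun t ht => ht.1) hW hq
  exact ⟨τ, h1, fun j => (mem_obsIn.1 (h2 j)).2, fun y => funext fun j => h3 y j⟩

/-! ### Measurability of the procedure -/

lemma measurable_card_obsIn (n : ℕ) {S : Set ℝ} (hS : MeasurableSet S) :
    Measurable fun x : ℕ → ℝ => (obsIn n x S).card := by
  classical
  simp only [obsIn, Finset.card_filter]
  refine Finset.measurable_sum _ fun k _ => ?_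
  exact Measurable.ite (measurable_pi_apply k hS) measurable_const measurable_const

lemma measurable_leftRank (x₀ : ℝ) (n k : ℕ) :
    Measurable fun x : ℕ → ℝ => leftRank x₀ n x k := by
  classical
  simp only [leftRank, obsIn, Finset.filter_filter, Finset.card_filter]
  refine Finset.measurable_sum _ fun i _ => Measurable.ite ?_ measurable_const measurable_const
  exact (measurable_pi_apply i measurableSet_Iio).inter
    ((measurableSet_lt (measurable_pi_apply k) (measurable_pi_apply i)).union
      ((measurableSet_eq_fun (measurable_pi_apply i) (measurable_pi_apply k)).inter
        (MeasurableSet.const _)))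

lemma measurable_rightRank (x₀ : ℝ) (n k : ℕ) :
    Measurable fun x : ℕ → ℝ => rightRank x₀ n x k := by
  classical
  simp only [rightRank, obsIn, Finset.filter_filter, Finset.card_filter]
  refine Finset.measurable_sum _ fun i _ => Measurable.ite ?_ measurable_const measurable_const
  exact (measurable_pi_apply i measurableSet_Ici).inter
    ((measurableSet_lt (measurable_pi_apply i) (measurable_pi_apply k)).union
      ((measurableSet_eq_fun (measurable_pi_apply i) (measurable_pi_apply k)).inter
        (MeasurableSet.const _)))

lemma measurable_leftSample (x₀ : ℝ) (q n : ℕ) :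
    Measurable fun p : (ℕ → ℝ) × (ℕ → ℝ) => leftSample x₀ q n p.1 p.2 := by
  classical
  refine measurable_pi_lambda _ fun j => ?_
  simp only [leftSample, obsIn, Finset.filter_filter, Finset.sum_filter]
  refine Finset.measurable_sum _ fun k _ => Measurable.ite ?_ (by fun_prop) measurable_const
  exact (measurableSet_Iio.preimage ((measurable_pi_apply k).comp measurable_fst)).inter
    (((measurable_leftRank x₀ n k).comp measurable_fst) (measurableSet_singleton (j : ℕ)))

lemma measurable_rightSample (x₀ : ℝ) (q n : ℕ) :
    Measurable fun p : (ℕ → ℝ) × (ℕ → ℝ) => rightSample x₀ q n p.1 p.2 := by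
  classical
  refine measurable_pi_lambda _ fun j => ?_
  simp only [rightSample, obsIn, Finset.filter_filter, Finset.sum_filter]
  refine Finset.measurable_sum _ fun k _ => Measurable.ite ?_ (by fun_prop) measurable_const
  exact (measurableSet_Ici.preimage ((measurable_pi_apply k).comp measurable_fst)).inter
    (((measurable_rightRank x₀ n k).comp measurable_fst) (measurableSet_singleton (j : ℕ)))

lemma measurableSet_rejects (H : NullFamily) (q : ℕ) (a r : ℝ) :
    MeasurableSet {p : (Fin q → ℝ) × (Fin q → ℝ) | Rejects H a p.1 p.2 r} := by
  have hm : Measurable fun p : (Fin q → ℝ) × (Fin q → ℝ) =>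
      (ecdfCount p.1 r, ecdfCount p.2 r) :=
    ((measurable_ecdfCount q _).comp measurable_fst).prodMk
      ((measurable_ecdfCount q _).comp measurable_snd)
  have h1 : MeasurableSet {p : (Fin q → ℝ) × (Fin q → ℝ) |
      BandsSeparate q a (ecdfCount p.1 r) (ecdfCount p.2 r)} :=
    hm (MeasurableSet.of_discrete (s := {c : ℕ × ℕ | BandsSeparate q a c.1 c.2}))
  have h2 : MeasurableSet {p : (Fin q → ℝ) × (Fin q → ℝ) |
      BandsSeparate q a (ecdfCount p.2 r) (ecdfCount p.1 r)} :=
    hm (MeasurableSet.of_discrete (s := {c : ℕ × ℕ | BandsSeparate q a c.2 c.1}))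
  cases H
  · exact h1.union h2
  · exact h1
  · exact h2

/-- The countable set of evaluation points must lie inside `T`, the true hypotheses, since a
rejection at a nearby point outside `T` is no error. -/
lemma measurableSet_exists_mem_rejects (H : NullFamily) (q : ℕ) (a : ℝ) (T : Set ℝ) :
    MeasurableSet {p : (Fin q → ℝ) × (Fin q → ℝ) | ∃ r ∈ T, Rejects H a p.1 p.2 r} := by
  obtain ⟨D, hDT, hD, hd⟩ := exists_countable_rightDense T
  have : {p : (Fin q → ℝ) × (Fin q → ℝ) | ∃ r ∈ T, Rejects H a p.1 p.2 r} =
      ⋃ r ∈ D, {p | Rejects H a p.1 p.2 r} := by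
    ext ⟨u, v⟩
    simp only [mem_ofPred_eq, mem_iUnion, exists_prop]
    constructor
    · rintro ⟨r, hr, hrej⟩
      obtain ⟨ε₁, h₁, he₁⟩ := eventually_ecdfCount_eq u r
      obtain ⟨ε₂, h₂, he₂⟩ := eventually_ecdfCount_eq v r
      obtain ⟨d, hdD, hd1, hd2⟩ := hd r hr (min ε₁ ε₂) (lt_min h₁ h₂)
      have := min_le_left ε₁ ε₂
      have := min_le_right ε₁ ε₂
      refine ⟨d, hdD, ?_⟩
      rw [rejects_iff] at hrej ⊢
      rw [he₁ d hd1 (by linarith), he₂ d hd1 (by linarith)]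
      exact hrej
    · rintro ⟨r, hr, hrej⟩
      exact ⟨r, hDT hr, hrej⟩
  rw [this]
  exact MeasurableSet.biUnion hD fun r _ => measurableSet_rejects H q a r

/-! ### Comparison of the familywise error with displaced rejections for uniform samples -/

lemma ecdfCount_condQuantile_le {κ : Kernel ℝ ℝ} {q : ℕ} {x u : Fin q → ℝ} {r c δ : ℝ}
    (hu : ∀ j, u j ∈ Ioo (0 : ℝ) 1) (h : ∀ j, |condF κ r (x j) - c| ≤ δ) :
    ecdfCount (fun j => condQuantile κ (x j) (u j)) r ≤ ecdfCount u (c + δ) := by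
  refine Finset.card_le_card (Finset.monotone_filter_right _ fun j _ hj => ?_)
  have := (condQuantile_le_iff κ (x j) (hu j) r).1 hj
  have := (abs_le.1 (h j)).2
  linarith

lemma le_ecdfCount_condQuantile {κ : Kernel ℝ ℝ} {q : ℕ} {x u : Fin q → ℝ} {r c δ : ℝ}
    (hu : ∀ j, u j ∈ Ioo (0 : ℝ) 1) (h : ∀ j, |condF κ r (x j) - c| ≤ δ) :
    ecdfCount u (c - δ) ≤ ecdfCount (fun j => condQuantile κ (x j) (u j)) r := by
  refine Finset.card_le_card (Finset.monotone_filter_right _ fun j _ hj => ?_)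
  refine (condQuantile_le_iff κ (x j) (hu j) r).2 ?_
  have := (abs_le.1 (h j)).1
  linarith

/-- Take `s = c`: the first count only grows on passing to `c + δ`, the second only drops on passing
to `d - δ` and then to `c - δ`. Thus `c = d` is the least favourable case. -/
lemma oneSidedReject_of_bandsSeparate {κ : Kernel ℝ ℝ} {q : ℕ} {a δ r c d : ℝ}
    {x u z v : Fin q → ℝ} (hu : ∀ j, u j ∈ Ioo (0 : ℝ) 1) (hv : ∀ j, v j ∈ Ioo (0 : ℝ) 1)
    (hx : ∀ j, |condF κ r (x j) - c| ≤ δ) (hz : ∀ j, |condF κ r (z j) - d| ≤ δ) (hcd : c ≤ d)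
    (h : BandsSeparate q a (ecdfCount (fun j => condQuantile κ (x j) (u j)) r)
      (ecdfCount (fun j => condQuantile κ (z j) (v j)) r)) :
    OneSidedReject a δ u v :=
  ⟨c, h.mono le_rfl (ecdfCount_condQuantile_le hu hx)
    ((ecdfCount_mono v (by linarith)).trans (le_ecdfCount_condQuantile hv hz))⟩

/-- A rejection of a true hypothesis is, on the uniform scale, a displaced rejection. -/
lemma blurredReject_of_rejects {κ : Kernel ℝ ℝ} {H : NullFamily} {q : ℕ} {a δ r c d : ℝ}
    {x u z v : Fin q → ℝ} (hu : ∀ j, u j ∈ Ioo (0 : ℝ) 1) (hv : ∀ j, v j ∈ Ioo (0 : ℝ) 1)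
    (hx : ∀ j, |condF κ r (x j) - c| ≤ δ) (hz : ∀ j, |condF κ r (z j) - d| ≤ δ)
    (hH : H.Holds c d)
    (h : Rejects H a (fun j => condQuantile κ (x j) (u j))
      (fun j => condQuantile κ (z j) (v j)) r) :
    BlurredReject H a δ u v := by
  rw [rejects_iff] at h
  cases H
  · exact h.imp (oneSidedReject_of_bandsSeparate hu hv hx hz (le_of_eq hH))
      (oneSidedReject_of_bandsSeparate hv hu hz hx (le_of_eq hH.symm))
  · exact oneSidedReject_of_bandsSeparate hu hv hx hz hH h
  · exact oneSidedReject_of_bandsSeparate hv hu hz hx hH h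

lemma map_infinitePi_unif_pair {q : ℕ} {σ τ : Fin q → ℕ}
    (h : Function.Injective (Sum.elim σ τ)) :
    (Measure.infinitePi fun _ : ℕ => unif).map
        (fun u => ((fun j => u (σ j) : Fin q → ℝ), (fun j => u (τ j) : Fin q → ℝ))) =
      (unifSample q).prod (unifSample q) := by
  have h1 := Measure.map_infinitePi_infinitePi_of_inj (P := fun _ : ℕ => unif) h
  rw [Measure.infinitePi_eq_pi (μ := fun _ : Fin q ⊕ Fin q => (unif : Measure ℝ))] at h1
  have h2 := (measurePreserving_sumPiEquivProdPi
    (fun _ : Fin q ⊕ Fin q => (unif : Measure ℝ))).map_eq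
  rw [← h1, Measure.map_map (MeasurableEquiv.measurable _) (by fun_prop)] at h2
  exact h2

/-- The samples of running variables with at least `q` observations in both windows. -/
def enoughObs (x₀ xl xu : ℝ) (q n : ℕ) : Set (ℕ → ℝ) :=
  {x | q ≤ (obsIn n x (Ico xl x₀)).card ∧ q ≤ (obsIn n x (Icc x₀ xu)).card}

lemma measurableSet_enoughObs (x₀ xl xu : ℝ) (q n : ℕ) :
    MeasurableSet (enoughObs x₀ xl xu q n) :=
  (measurableSet_le measurable_const (measurable_card_obsIn n measurableSet_Ico)).inter
    (measurableSet_le measurable_const (measurable_card_obsIn n measurableSet_Icc))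

/-- The samples that lead to a familywise error. -/
def errorSamples (H : NullFamily) (α x₀ : ℝ) (q n : ℕ) (νm νp : Measure ℝ) :
    Set ((ℕ → ℝ) × (ℕ → ℝ)) :=
  {p | ∃ r : ℝ, H.Holds (cdf νm r) (cdf νp r) ∧ RDRejects H α x₀ q n p.1 p.2 r}

lemma measurableSet_errorSamples (H : NullFamily) (α x₀ : ℝ) (q n : ℕ) (νm νp : Measure ℝ) :
    MeasurableSet (errorSamples H α x₀ q n νm νp) := by
  have : errorSamples H α x₀ q n νm νp =
      ({p | q ≤ (obsIn n p.1 (Iio x₀)).card} ∩ {p | q ≤ (obsIn n p.1 (Ici x₀)).card}) ∩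
      (fun p => (leftSample x₀ q n p.1 p.2, rightSample x₀ q n p.1 p.2)) ⁻¹'
        {s | ∃ r ∈ {r | H.Holds (cdf νm r) (cdf νp r)},
          Rejects H (calibratedLevel H q q α) s.1 s.2 r} := by
    ext p
    constructor
    · rintro ⟨r, h1, h2, h3, h4⟩
      exact ⟨⟨h2, h3⟩, r, h1, h4⟩
    · rintro ⟨⟨h2, h3⟩, r, h1, h4⟩
      exact ⟨r, h1, h2, h3, h4⟩
  rw [this]
  refine ((measurableSet_le measurable_const
    ((measurable_card_obsIn n measurableSet_Iio).comp measurable_fst)).inter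
    (measurableSet_le measurable_const
      ((measurable_card_obsIn n measurableSet_Ici).comp measurable_fst))).inter ?_
  exact ((measurable_leftSample x₀ q n).prodMk (measurable_rightSample x₀ q n))
    (measurableSet_exists_mem_rejects H q _ _)

lemma ae_forall_infinitePi_unif_mem_Ioo :
    ∀ᵐ u ∂(Measure.infinitePi fun _ : ℕ => unif), ∀ k, u k ∈ Ioo (0 : ℝ) 1 :=
  ae_all_iff.2 fun k =>
    (measurePreserving_eval_infinitePi (fun _ : ℕ => unif) k).quasiMeasurePreserving.ae
      ae_unif_mem_Ioo

section Core

variable {x₀ xl xu : ℝ} {q n : ℕ}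

/-- For fixed `x` the selected indices are deterministic, and those of the two sides are disjoint
because the sides are separated by `x₀`. -/
lemma measure_blurredReject_nearest (H : NullFamily) (a δ : ℝ) {x : ℕ → ℝ}
    (hx : x ∈ enoughObs x₀ xl xu q n) :
    (Measure.infinitePi fun _ : ℕ => unif)
        {u | BlurredReject H a δ (leftSample x₀ q n x u) (rightSample x₀ q n x u)} =
      ((unifSample q).prod (unifSample q)) {p | BlurredReject H a δ p.1 p.2} := by
  obtain ⟨σ, hσ, hσx, hσy⟩ := exists_leftSample_eq hx.1
  obtain ⟨τ, hτ, hτx, hτy⟩ := exists_rightSample_eq hx.2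
  have hinj : Function.Injective (Sum.elim σ τ) := hσ.sumElim hτ fun i j h => by
    have h1 := (hσx i).2
    rw [h] at h1
    exact absurd h1 (not_lt.2 (hτx j).1)
  rw [← map_infinitePi_unif_pair hinj, Measure.map_apply (by fun_prop)
    (measurableSet_blurredReject H q a δ)]
  simp only [hσy, hτy]
  rfl

/-- If the conditional distribution functions over two windows at the cutoff are within `δ` of the
boundary distribution functions, then the probability of a familywise error when both windows have
enough observations is bounded through displaced rejections for uniform samples. -/
lemma measure_error_inter_enoughObs_le (PX : Measure ℝ) (κ : Kernel ℝ ℝ) [IsMarkovKernel κ]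
    (νm νp : Measure ℝ) (H : NullFamily) (α : ℝ) {δ : ℝ}
    (hm : ∀ x ∈ Ico xl x₀, ∀ y, |condF κ y x - cdf νm y| ≤ δ)
    (hp : ∀ x ∈ Icc x₀ xu, ∀ y, |condF κ y x - cdf νp y| ≤ δ) :
    ((Measure.infinitePi fun _ : ℕ => PX).prod (Measure.infinitePi fun _ : ℕ => unif))
        {p | p.1 ∈ enoughObs x₀ xl xu q n ∧
          (p.1, fun i => condQuantile κ (p.1 i) (p.2 i)) ∈ errorSamples H α x₀ q n νm νp} ≤
      ((unifSample q).prod (unifSample q))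
        {p | BlurredReject H (calibratedLevel H q q α) δ p.1 p.2} *
        (Measure.infinitePi fun _ : ℕ => PX) (enoughObs x₀ xl xu q n) := by
  set a := calibratedLevel H q q α
  set M := (Measure.infinitePi fun _ : ℕ => PX).prod (Measure.infinitePi fun _ : ℕ => unif)
  set A := enoughObs x₀ xl xu q n
  set B : Set ((ℕ → ℝ) × (ℕ → ℝ)) := {p | p.1 ∈ A ∧
    BlurredReject H a δ (leftSample x₀ q n p.1 p.2) (rightSample x₀ q n p.1 p.2)} with hB
  have hBm : MeasurableSet B :=
    (measurable_fst (measurableSet_enoughObs x₀ xl xu q n)).inter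
      (((measurable_leftSample x₀ q n).prodMk (measurable_rightSample x₀ q n))
        (measurableSet_blurredReject H q a δ))
  have hae : ∀ᵐ p ∂M, ∀ k, p.2 k ∈ Ioo (0 : ℝ) 1 :=
    Measure.quasiMeasurePreserving_snd.ae ae_forall_infinitePi_unif_mem_Ioo
  calc M {p | p.1 ∈ A ∧
          (p.1, fun i => condQuantile κ (p.1 i) (p.2 i)) ∈ errorSamples H α x₀ q n νm νp}
      ≤ M B := by
        refine measure_mono_ae ?_
        filter_upwards [hae] with p hp' hpA
        obtain ⟨hA, r, hH, -, -, hrej⟩ := hpA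
        refine ⟨hA, ?_⟩
        obtain ⟨σ, -, hσx, hσy⟩ := exists_leftSample_eq hA.1
        obtain ⟨τ, -, hτx, hτy⟩ := exists_rightSample_eq hA.2
        simp only [hσy, hτy, DirichletRejects] at hrej ⊢
        exact blurredReject_of_rejects (κ := κ) (fun j => hp' (σ j)) (fun j => hp' (τ j))
          (fun j => hm _ (hσx j) r) (fun j => hp _ (hτx j) r) hH hrej
    -- Fubini: for each `x` in `A` the inner probability is the same constant.
    _ = ∫⁻ x, A.indicator (fun _ => ((unifSample q).prod (unifSample q))
          {p | BlurredReject H a δ p.1 p.2}) x ∂(Measure.infinitePi fun _ : ℕ => PX) := by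
        rw [Measure.prod_apply hBm]
        refine lintegral_congr fun x => ?_
        by_cases hx : x ∈ A
        · rw [indicator_of_mem hx, ← measure_blurredReject_nearest H a δ hx]
          congr 1
          ext u
          simp [hB, hx]
        · rw [indicator_of_notMem hx]
          have : Prod.mk x ⁻¹' B = ∅ := by
            ext u
            simp [hB, hx]
          rw [this, measure_empty]
    _ = _ := by
        rw [lintegral_indicator (measurableSet_enoughObs x₀ xl xu q n), setLIntegral_const]

end Core

section Sample

variable {Ω : Type*} [MeasurableSpace Ω] (P : Measure Ω) [IsProbabilityMeasure P]
  (X Y : ℕ → Ω → ℝ)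

lemma measure_familywiseError_inter_le (hX : ∀ i, Measurable (X i)) (hY : ∀ i, Measurable (Y i))
    (hindep : iIndepFun (fun i ω => (X i ω, Y i ω)) P)
    (hident : ∀ i, IdentDistrib (fun ω => (X i ω, Y i ω)) (fun ω => (X 0 ω, Y 0 ω)) P P)
    (κ : Kernel ℝ ℝ) [IsMarkovKernel κ]
    (hκ : (P.map (X 0)).compProd κ = P.map (fun ω => (X 0 ω, Y 0 ω)))
    (νm νp : Measure ℝ) (H : NullFamily) (α : ℝ) {x₀ xl xu δ : ℝ} (q n : ℕ)
    (hm : ∀ x ∈ Ico xl x₀, ∀ y, |condF κ y x - cdf νm y| ≤ δ)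
    (hp : ∀ x ∈ Icc x₀ xu, ∀ y, |condF κ y x - cdf νp y| ≤ δ) :
    P ({ω | (fun i => X i ω) ∈ enoughObs x₀ xl xu q n} ∩
        familywiseError H α x₀ q n νm νp X Y) ≤
      ((unifSample q).prod (unifSample q))
        {p | BlurredReject H (calibratedLevel H q q α) δ p.1 p.2} *
        P {ω | (fun i => X i ω) ∈ enoughObs x₀ xl xu q n} := by
  have hPX : IsProbabilityMeasure (P.map (X 0)) :=
    Measure.isProbabilityMeasure_map (hX 0).aemeasurable
  have hlaw := map_sample_eq P X Y hX hY hindep hident κ hκ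
  set M := (Measure.infinitePi fun _ : ℕ => P.map (X 0)).prod
    (Measure.infinitePi fun _ : ℕ => unif)
  have hZ : Measurable fun ω => (fun i => X i ω, fun i => Y i ω) :=
    (measurable_pi_lambda _ hX).prodMk (measurable_pi_lambda _ hY)
  have hpair : ∀ i : ℕ, Measurable fun p : (ℕ → ℝ) × (ℕ → ℝ) => (p.1 i, p.2 i) := fun i => by
    fun_prop
  have hQ : Measurable fun p : (ℕ → ℝ) × (ℕ → ℝ) =>
      (p.1, fun i => condQuantile κ (p.1 i) (p.2 i)) :=
    measurable_fst.prodMk (measurable_pi_lambda _ fun i =>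
      (measurable_condQuantile κ).comp (hpair i))
  have htransfer : ∀ s : Set ((ℕ → ℝ) × (ℕ → ℝ)), MeasurableSet s →
      P ((fun ω => (fun i => X i ω, fun i => Y i ω)) ⁻¹' s) =
        M ((fun p => (p.1, fun i => condQuantile κ (p.1 i) (p.2 i))) ⁻¹' s) := fun s hs => by
    rw [← Measure.map_apply hZ hs, hlaw, Measure.map_apply hQ hs]
  have hA : MeasurableSet {p : (ℕ → ℝ) × (ℕ → ℝ) | p.1 ∈ enoughObs x₀ xl xu q n} :=
    measurable_fst (measurableSet_enoughObs x₀ xl xu q n)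
  have h1 := htransfer _ (hA.inter (measurableSet_errorSamples H α x₀ q n νm νp))
  have h2 := htransfer _ hA
  have h3 : M {p | p.1 ∈ enoughObs x₀ xl xu q n} =
      (Measure.infinitePi fun _ : ℕ => P.map (X 0)) (enoughObs x₀ xl xu q n) := by
    have := measurePreserving_fst (μ := Measure.infinitePi fun _ : ℕ => P.map (X 0))
      (ν := Measure.infinitePi fun _ : ℕ => unif)
    exact this.measure_preimage (measurableSet_enoughObs x₀ xl xu q n).nullMeasurableSet
  refine (le_of_eq h1).trans ((measure_error_inter_enoughObs_le (q := q) (n := n) (P.map (X 0))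
    κ νm νp H α hm hp).trans (le_of_eq ?_))
  rw [← h3]
  exact congrArg _ h2.symm

/-- Finite-sample control of the familywise error rate. -/
lemma cond_familywiseError_le (hX : ∀ i, Measurable (X i)) (hY : ∀ i, Measurable (Y i))
    (hindep : iIndepFun (fun i ω => (X i ω, Y i ω)) P)
    (hident : ∀ i, IdentDistrib (fun ω => (X i ω, Y i ω)) (fun ω => (X 0 ω, Y 0 ω)) P P)
    (κ : Kernel ℝ ℝ) [IsMarkovKernel κ]
    (hκ : (P.map (X 0)).compProd κ = P.map (fun ω => (X 0 ω, Y 0 ω)))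
    (νm νp : Measure ℝ) (H : NullFamily) (α : ℝ) {x₀ xl xu : ℝ} (q n : ℕ)
    (hm : ∀ x ∈ Ico xl x₀, ∀ y, condF κ y x = cdf νm y)
    (hp : ∀ x ∈ Icc x₀ xu, ∀ y, condF κ y x = cdf νp y) :
    P[familywiseError H α x₀ q n νm νp X Y |
      {ω | (fun i => X i ω) ∈ enoughObs x₀ xl xu q n}] ≤ ENNReal.ofReal α := by
  have hA : MeasurableSet {ω | (fun i => X i ω) ∈ enoughObs x₀ xl xu q n} :=
    measurable_pi_lambda _ hX (measurableSet_enoughObs x₀ xl xu q n)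
  rw [cond_apply hA, mul_comm, ← div_eq_mul_inv]
  -- Exact windows allow `δ = 0`. The conditioning event may be null, as this division bound needs
  -- no positivity.
  refine ENNReal.div_le_of_le_mul ((measure_familywiseError_inter_le P X Y hX hY hindep hident κ
    hκ νm νp H α q n (δ := 0) (fun x hx y => by simp [hm x hx y])
    (fun x hx y => by simp [hp x hx y])).trans ?_)
  rw [← unifFWER_eq]
  gcongr
  exact unifFWER_calibratedLevel_le H q α

end Sample

/-! ### Asymptotics -/

/-- Pointwise convergence of distribution functions to a continuous one is uniform. -/
lemma eventually_forall_abs_condF_sub_le {κ : Kernel ℝ ℝ} {ν : Measure ℝ}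
    (hν : Continuous fun r => cdf ν r) {l : Filter ℝ}
    (h : ∀ r : ℝ, Tendsto (condF κ r) l (𝓝 (cdf ν r))) {δ : ℝ} (hδ : 0 < δ) :
    ∀ᶠ x in l, ∀ r, |condF κ r x - cdf ν r| ≤ δ := by
  -- The levels `i / K` contribute one `1 / K` for the grid spacing and one for the error at grid
  -- points, in total at most `δ`.
  obtain ⟨K, hK⟩ := exists_nat_gt (2 / δ)
  have hK0 : (0 : ℝ) < K := (by positivity : (0 : ℝ) < 2 / δ).trans hK
  have hKδ : 2 / (K : ℝ) ≤ δ := by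
    rw [div_lt_iff₀ hδ] at hK
    rw [div_le_iff₀ hK0]
    linarith
  have hgrid : ∀ i : ℕ, 0 < i → i < K → ∃ r, cdf ν r = (i : ℝ) / K := by
    intro i hi hiK
    have h0 : (0 : ℝ) < (i : ℝ) / K := by positivity
    have h1 : (i : ℝ) / K < 1 := by
      rw [div_lt_one hK0]
      exact_mod_cast hiK
    obtain ⟨b, hb⟩ := ((tendsto_cdf_atBot ν).eventually_lt_const h0).exists
    obtain ⟨c, hc⟩ := ((tendsto_cdf_atTop ν).eventually_const_lt h1).exists
    exact mem_range_of_exists_le_of_exists_ge hν ⟨b, hb.le⟩ ⟨c, hc.le⟩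
  choose! g hg using hgrid
  have hev : ∀ᶠ x in l, ∀ i ∈ Finset.range K, |condF κ (g i) x - cdf ν (g i)| < 1 / K := by
    refine (Finset.eventually_all _).2 fun i _ => ?_
    have := (h (g i)).eventually (Metric.ball_mem_nhds _ (by positivity : (0 : ℝ) < 1 / K))
    exact this
  filter_upwards [hev] with x hx r
  have hx' : ∀ i : ℕ, 0 < i → i < K →
      ((i : ℝ) - 1) / K ≤ condF κ (g i) x ∧ condF κ (g i) x ≤ ((i : ℝ) + 1) / K := by
    intro i hi hiK
    have h1 := abs_lt.1 (hx i (Finset.mem_range.2 hiK))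
    rw [hg i hi hiK] at h1
    rw [sub_div, add_div]
    exact ⟨by linarith [h1.1], by linarith [h1.2]⟩
  have ht0 : 0 ≤ cdf ν r := cdf_nonneg ν r
  have ht1 : cdf ν r ≤ 1 := cdf_le_one ν r
  have hx0 : 0 ≤ condF κ r x := cdf_nonneg (κ x) r
  have hx1 : condF κ r x ≤ 1 := cdf_le_one (κ x) r
  have hKK : 2 / (K : ℝ) = 1 / K + 1 / K := by ring
  refine abs_le.2 ⟨?_, ?_⟩
  -- Compare with the largest grid level strictly below `cdf ν r`, of index ceiling minus one. If
  -- that index is not positive, then `cdf ν r ≤ 1 / K` and `0 ≤ condF κ r x` suffices.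
  · rcases Nat.lt_or_ge 1 ⌈cdf ν r * K⌉₊ with hc | hc
    · obtain ⟨i, hi⟩ : ∃ i, ⌈cdf ν r * K⌉₊ = i + 1 := ⟨_, (Nat.succ_pred_eq_of_pos (by omega)).symm⟩
      have hle : ⌈cdf ν r * K⌉₊ ≤ K := Nat.ceil_le.2 (by nlinarith)
      have hiK : i < K := by omega
      have hi0 : 0 < i := by omega
      have h1 : (i : ℝ) < cdf ν r * K := Nat.lt_ceil.1 (by omega)
      have h2 : cdf ν r * K ≤ (i : ℝ) + 1 := by
        have := Nat.le_ceil (cdf ν r * K)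
        rw [hi] at this
        exact_mod_cast this
      have h3 : g i ≤ r := by
        by_contra hcon
        have := monotone_cdf ν (not_le.1 hcon).le
        rw [hg i hi0 hiK, le_div_iff₀ hK0] at this
        linarith
      have h4 : condF κ (g i) x ≤ condF κ r x := monotone_cdf (κ x) h3
      have h5 := (hx' i hi0 hiK).1
      rw [← le_div_iff₀ hK0] at h2
      have e1 : ((i : ℝ) + 1) / K = ((i : ℝ) - 1) / K + 2 / K := by ring
      linarith
    · have h1 : cdf ν r * K ≤ 1 := by
        have := Nat.le_ceil (cdf ν r * K)
        have h' : (⌈cdf ν r * K⌉₊ : ℝ) ≤ 1 := by exact_mod_cast hc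
        linarith
      rw [← le_div_iff₀ hK0] at h1
      have : 0 < 1 / (K : ℝ) := by positivity
      linarith
  · have h1 : cdf ν r * K < (⌊cdf ν r * K⌋₊ : ℝ) + 1 := Nat.lt_floor_add_one _
    have h2 : (⌊cdf ν r * K⌋₊ : ℝ) ≤ cdf ν r * K := Nat.floor_le (by positivity)
    -- Symmetrically, use the smallest grid level strictly above `cdf ν r`; near the top, `condF κ r
    -- x ≤ 1` suffices.
    rcases Nat.lt_or_ge (⌊cdf ν r * K⌋₊ + 1) K with hc | hc
    · have h3 : r ≤ g (⌊cdf ν r * K⌋₊ + 1) := by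
        by_contra hcon
        have := monotone_cdf ν (not_le.1 hcon).le
        rw [hg _ (Nat.succ_pos _) hc, div_le_iff₀ hK0] at this
        push_cast at this
        linarith
      have h4 : condF κ r x ≤ condF κ (g (⌊cdf ν r * K⌋₊ + 1)) x := monotone_cdf (κ x) h3
      have h5 := (hx' _ (Nat.succ_pos _) hc).2
      push_cast at h5
      have h6 : (⌊cdf ν r * K⌋₊ : ℝ) / K ≤ cdf ν r := by
        rwa [div_le_iff₀ hK0]
      have e1 : ((⌊cdf ν r * K⌋₊ : ℝ) + 1 + 1) / K = (⌊cdf ν r * K⌋₊ : ℝ) / K + 2 / K := by ring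
      linarith
    · have h3 : (K : ℝ) ≤ (⌊cdf ν r * K⌋₊ : ℝ) + 1 := by exact_mod_cast hc
      have h4 : 1 - cdf ν r ≤ 1 / K := by
        rw [le_div_iff₀ hK0]
        linarith
      have : 0 < 1 / (K : ℝ) := by positivity
      linarith

lemma exists_left_window {κ : Kernel ℝ ℝ} {ν : Measure ℝ} (hν : RegularCDF ν) {x₀ : ℝ}
    (h : IsLeftBoundary κ x₀ ν) {δ : ℝ} (hδ : 0 < δ) :
    ∃ xl < x₀, ∀ x ∈ Ico xl x₀, ∀ y, |condF κ y x - cdf ν y| ≤ δ := by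
  obtain ⟨l, hl, hs⟩ := (mem_nhdsLT_iff_exists_Ico_subset (a := x₀)).1
    (eventually_forall_abs_condF_sub_le hν.1 h hδ)
  exact ⟨l, hl, fun x hx => hs hx⟩

/-- The window must include `x₀`. Without an atom, right-continuity identifies `condF κ y x₀` with
the right limit; with an atom, `{x₀}` alone has positive mass and serves as the window. -/
lemma exists_right_window {κ : Kernel ℝ ℝ} {PX ν : Measure ℝ} (hν : RegularCDF ν) {x₀ : ℝ}
    (h : IsRightBoundary PX κ x₀ ν)
    (hc : 0 < PX {x₀} ∨ ∀ y : ℝ, ContinuousWithinAt (condF κ y) (Ici x₀) x₀)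
    (hright : ∀ ε : ℝ, 0 < ε → 0 < PX (Icc x₀ (x₀ + ε))) {δ : ℝ} (hδ : 0 < δ) :
    ∃ xu, 0 < PX (Icc x₀ xu) ∧ ∀ x ∈ Icc x₀ xu, ∀ y, |condF κ y x - cdf ν y| ≤ δ := by
  rcases eq_or_ne (PX {x₀}) 0 with h0 | h0
  · have hlim := h.2 h0
    have hcont := hc.resolve_left (by simp [h0])
    have hlim' : ∀ y, Tendsto (condF κ y) (𝓝[≥] x₀) (𝓝 (cdf ν y)) := fun y => by
      have h1 : Tendsto (condF κ y) (𝓝[≥] x₀) (𝓝 (condF κ y x₀)) := hcont y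
      rwa [tendsto_nhds_unique
        (h1.mono_left (nhdsWithin_mono x₀ Ioi_subset_Ici_self)) (hlim y)] at h1
    obtain ⟨u, hu, hs⟩ := (mem_nhdsGE_iff_exists_Icc_subset (a := x₀)).1
      (eventually_forall_abs_condF_sub_le hν.1 hlim' hδ)
    refine ⟨u, ?_, fun x hx => hs hx⟩
    have := hright (u - x₀) (sub_pos.2 hu)
    rwa [add_sub_cancel] at this
  · refine ⟨x₀, by rwa [Icc_self, pos_iff_ne_zero], fun x hx y => ?_⟩
    rw [Icc_self, mem_singleton_iff] at hx
    rw [hx, h.1 (pos_iff_ne_zero.2 h0) y, sub_self, abs_zero]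
    exact hδ.le

/-- The number of observations in a set of positive probability exceeds any bound, with
probability tending to one. -/
lemma tendsto_measure_card_obsIn_lt {Ω : Type*} [MeasurableSpace Ω] (P : Measure Ω)
    [IsProbabilityMeasure P] {X : ℕ → Ω → ℝ} (hX : ∀ i, Measurable (X i)) (hindep : iIndepFun X P)
    (hident : ∀ i, P.map (X i) = P.map (X 0)) {W : Set ℝ} (hW : MeasurableSet W)
    (hpos : 0 < P.map (X 0) W) (q : ℕ) :
    Tendsto (fun n => P {ω | (obsIn n (fun i => X i ω) W).card < q}) atTop (𝓝 0) := by
  have hm : ∀ n, MeasurableSet {ω | (obsIn n (fun i => X i ω) W).card < q} := fun n =>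
    measurableSet_lt ((measurable_card_obsIn n hW).comp (measurable_pi_lambda _ hX))
      measurable_const
  have hanti : Antitone fun n => {ω | (obsIn n (fun i => X i ω) W).card < q} := by
    intro m n hmn ω hω
    refine lt_of_le_of_lt (Finset.card_le_card fun k hk => ?_) hω
    exact mem_obsIn.2 ⟨(mem_obsIn.1 hk).1.trans_le hmn, (mem_obsIn.1 hk).2⟩
  have hlim := tendsto_measure_iInter_atTop (μ := P) (fun n => (hm n).nullMeasurableSet) hanti
    ⟨0, measure_ne_top _ _⟩
  have hind : iIndepSet (fun n => X n ⁻¹' W) P := by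
    rw [iIndepSet_iff_meas_biInter fun n => hX n hW]
    exact fun s => hindep.measure_inter_preimage_eq_mul s fun _ _ => hW
  -- Second Borel–Cantelli lemma: almost surely infinitely many observations fall in `W`, so the
  -- decreasing events have null intersection.
  have hone := measure_limsup_eq_one (fun n => hX n hW) hind (by
    have : ∀ n, P (X n ⁻¹' W) = P.map (X 0) W := fun n => by
      rw [← hident n, Measure.map_apply (hX n) hW]
    simp_rw [this]
    exact ENNReal.tsum_const_eq_top_of_ne_zero hpos.ne')
  have hsub : (⋂ n, {ω | (obsIn n (fun i => X i ω) W).card < q}) ⊆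
      (limsup (fun n => X n ⁻¹' W) atTop)ᶜ := by
    intro ω hω hcon
    rw [mem_limsup_iff_frequently_mem, Nat.frequently_atTop_iff_infinite] at hcon
    obtain ⟨t, ht, hcard⟩ := hcon.exists_subset_card_eq q
    have h1 : t ⊆ obsIn (t.sup id + 1) (fun i => X i ω) W := fun k hk =>
      mem_obsIn.2 ⟨Nat.lt_succ_of_le (Finset.le_sup (f := id) hk), ht hk⟩
    have h2 : (obsIn (t.sup id + 1) (fun i => X i ω) W).card < q := mem_iInter.1 hω _
    have := Finset.card_le_card h1
    omega
  have hnull : P (⋂ n, {ω | (obsIn n (fun i => X i ω) W).card < q}) = 0 :=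
    measure_mono_null hsub ((prob_compl_eq_zero_iff
      (MeasurableSet.measurableSet_limsup fun n => hX n hW)).2 hone)
  rw [hnull] at hlim
  exact hlim

section Asymptotic

variable {Ω : Type*} [MeasurableSpace Ω] (P : Measure Ω) [IsProbabilityMeasure P]
  (X Y : ℕ → Ω → ℝ)

/-- Outside an event of vanishing probability both windows hold `q` observations, and there the
bound for fixed `δ` does not depend on `n`. -/
lemma limsup_familywiseError_le_blurred (hX : ∀ i, Measurable (X i))
    (hY : ∀ i, Measurable (Y i)) (hindep : iIndepFun (fun i ω => (X i ω, Y i ω)) P)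
    (hident : ∀ i, IdentDistrib (fun ω => (X i ω, Y i ω)) (fun ω => (X 0 ω, Y 0 ω)) P P)
    (κ : Kernel ℝ ℝ) [IsMarkovKernel κ]
    (hκ : (P.map (X 0)).compProd κ = P.map (fun ω => (X 0 ω, Y 0 ω)))
    (νm νp : Measure ℝ) (H : NullFamily) (α : ℝ) {x₀ xl xu δ : ℝ} (q : ℕ)
    (hm : ∀ x ∈ Ico xl x₀, ∀ y, |condF κ y x - cdf νm y| ≤ δ)
    (hp : ∀ x ∈ Icc x₀ xu, ∀ y, |condF κ y x - cdf νp y| ≤ δ)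
    (hl : 0 < P.map (X 0) (Ico xl x₀)) (hr : 0 < P.map (X 0) (Icc x₀ xu)) :
    limsup (fun n : ℕ => P (familywiseError H α x₀ q n νm νp X Y)) atTop ≤
      ((unifSample q).prod (unifSample q))
        {p | BlurredReject H (calibratedLevel H q q α) δ p.1 p.2} := by
  set c := ((unifSample q).prod (unifSample q))
    {p | BlurredReject H (calibratedLevel H q q α) δ p.1 p.2}
  have hindX : iIndepFun X P := hindep.comp (fun _ => Prod.fst) fun _ => measurable_fst
  have hidX : ∀ i, P.map (X i) = P.map (X 0) := fun i =>
    ((hident i).comp measurable_fst).map_eq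
  have ht := (((tendsto_measure_card_obsIn_lt P hX hindX hidX measurableSet_Ico hl q).add
    (tendsto_measure_card_obsIn_lt P hX hindX hidX measurableSet_Icc hr q)).const_add c)
  rw [add_zero, add_zero] at ht
  rw [← ht.limsup_eq]
  refine limsup_le_limsup (Eventually.of_forall fun n => ?_)
  have hsub : familywiseError H α x₀ q n νm νp X Y ⊆
      ({ω | (fun i => X i ω) ∈ enoughObs x₀ xl xu q n} ∩
        familywiseError H α x₀ q n νm νp X Y) ∪
      ({ω | (obsIn n (fun i => X i ω) (Ico xl x₀)).card < q} ∪
        {ω | (obsIn n (fun i => X i ω) (Icc x₀ xu)).card < q}) := by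
    intro ω hω
    by_cases h1 : (obsIn n (fun i => X i ω) (Ico xl x₀)).card < q
    · exact Or.inr (Or.inl h1)
    by_cases h2 : (obsIn n (fun i => X i ω) (Icc x₀ xu)).card < q
    · exact Or.inr (Or.inr h2)
    exact Or.inl ⟨⟨not_lt.1 h1, not_lt.1 h2⟩, hω⟩
  refine (measure_mono hsub).trans ((measure_union_le _ _).trans
    (add_le_add ?_ (measure_union_le _ _)))
  exact (measure_familywiseError_inter_le P X Y hX hY hindep hident κ hκ νm νp H α q n hm hp).trans
    (mul_le_of_le_one_right zero_le prob_le_one)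

/-- Asymptotic control of the familywise error rate. -/
lemma limsup_familywiseError_le (hX : ∀ i, Measurable (X i))
    (hY : ∀ i, Measurable (Y i)) (hindep : iIndepFun (fun i ω => (X i ω, Y i ω)) P)
    (hident : ∀ i, IdentDistrib (fun ω => (X i ω, Y i ω)) (fun ω => (X 0 ω, Y 0 ω)) P P)
    (κ : Kernel ℝ ℝ) [IsMarkovKernel κ]
    (hκ : (P.map (X 0)).compProd κ = P.map (fun ω => (X 0 ω, Y 0 ω)))
    (x₀ : ℝ) (νm νp : Measure ℝ) (hνm : RegularCDF νm) (hνp : RegularCDF νp)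
    (hleft : ∀ ε : ℝ, 0 < ε → 0 < P.map (X 0) (Ico (x₀ - ε) x₀))
    (hright : ∀ ε : ℝ, 0 < ε → 0 < P.map (X 0) (Icc x₀ (x₀ + ε)))
    (q : ℕ) (α : ℝ) (H : NullFamily) (hL : IsLeftBoundary κ x₀ νm)
    (hR : IsRightBoundary (P.map (X 0)) κ x₀ νp)
    (hc : 0 < P.map (X 0) {x₀} ∨ ∀ y : ℝ, ContinuousWithinAt (condF κ y) (Ici x₀) x₀) :
    limsup (fun n : ℕ => P (familywiseError H α x₀ q n νm νp X Y)) atTop ≤ ENNReal.ofReal α := by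
  -- Order of limits: `n` tends to infinity for fixed `δ`, and only then `δ` tends to `0`; the left
  -- side is free of `δ`.
  refine (le_unifFWER_of_forall_le_blurred H q _ fun δ hδ => ?_).trans
    (unifFWER_calibratedLevel_le H q α)
  obtain ⟨xl, hxl, hm⟩ := exists_left_window hνm hL hδ
  obtain ⟨xu, hxu, hp⟩ := exists_right_window hνp hR hc hright hδ
  have hl := hleft (x₀ - xl) (sub_pos.2 hxl)
  rw [sub_sub_cancel] at hl
  exact limsup_familywiseError_le_blurred P X Y hX hY hindep hident κ hκ νm νp H α q hm hp hl hxu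

end Asymptotic

theorem mainTheorem8
    {Ω : Type*} [MeasurableSpace Ω] (P : Measure Ω) [IsProbabilityMeasure P]
    (X Y : ℕ → Ω → ℝ)
    (hX : ∀ i, Measurable (X i)) (hY : ∀ i, Measurable (Y i))
    -- iid sampling of the pairs (X i, Y i)
    (hindep : iIndepFun (fun i ω => (X i ω, Y i ω)) P)
    (hident : ∀ i, IdentDistrib (fun ω => (X i ω, Y i ω)) (fun ω => (X 0 ω, Y 0 ω)) P P)
    -- `κ` is a regular conditional distribution of the outcome given the running variable
    (κ : Kernel ℝ ℝ) [IsMarkovKernel κ]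
    (hκ : (P.map (X 0)).compProd κ = P.map (fun ω => (X 0 ω, Y 0 ω)))
    -- the two boundary distributions at the cutoff `x₀`
    (x₀ : ℝ) (νm νp : Measure ℝ) [IsProbabilityMeasure νm] [IsProbabilityMeasure νp]
    (hνm : RegularCDF νm) (hνp : RegularCDF νp)
    -- the running variable charges every one-sided neighbourhood of the cutoff
    (hleft : ∀ ε : ℝ, 0 < ε → 0 < P.map (X 0) (Ico (x₀ - ε) x₀))
    (hright : ∀ ε : ℝ, 0 < ε → 0 < P.map (X 0) (Icc x₀ (x₀ + ε)))
    (q : ℕ) (hq : 0 < q) (α : ℝ) (hα : α ∈ Ioo (0 : ℝ) 1) (H : NullFamily) :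
    -- asymptotic strong control of FWER
    (IsLeftBoundary κ x₀ νm → IsRightBoundary (P.map (X 0)) κ x₀ νp →
      (∃ ε : ℝ, 0 < ε ∧ ∀ x ∈ Ico (x₀ - ε) x₀, ∀ y : ℝ,
        ContinuousWithinAt (condF κ y) (Iic x) x) →
      (0 < P.map (X 0) {x₀} ∨ ∀ y : ℝ, ContinuousWithinAt (condF κ y) (Ici x₀) x₀) →
      limsup (fun n : ℕ => P (familywiseError H α x₀ q n νm νp X Y)) atTop ≤ ENNReal.ofReal α) ∧
    -- finite-sample strong control of FWER
    (∀ xl xu : ℝ, xl < x₀ → x₀ ≤ xu →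
      (∀ x ∈ Ico xl x₀, ∀ y : ℝ, condF κ y x = cdf νm y) →
      (∀ x ∈ Icc x₀ xu, ∀ y : ℝ, condF κ y x = cdf νp y) →
      ∀ n : ℕ,
        P[familywiseError H α x₀ q n νm νp X Y |
          {ω | q ≤ (obsIn n (fun i => X i ω) (Ico xl x₀)).card ∧
            q ≤ (obsIn n (fun i => X i ω) (Icc x₀ xu)).card}] ≤ ENNReal.ofReal α) := by

  refine ⟨fun hL hR _ hc => ?_, fun xl xu _ _ hm hp n => ?_⟩
  · exact limsup_familywiseError_le P X Y hX hY hindep hident κ hκ x₀ νm νp hνm hνp hleft hright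
      q α H hL hR hc
  · exact cond_familywiseError_le P X Y hX hY hindep hident κ hκ νm νp H α q n hm hp
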